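/- Let $\Bbbk$ be an algebraically closed field of characteristic $0$, let $\mathcal S=\Bbbk[X_0,\dots,X_n]$ and $\mathcal R=\Bbbk[Y_0,\dots,Y_n]$, and let $\mathcal R$ act on $\mathcal S$ by differentiation, $Y^\beta\circ X^\alpha=\frac{\alpha!}{(\alpha-\beta)!}X^{\alpha-\beta}$ if $\beta\le\alpha$ and $0$ otherwise. View $\mathcal R$ as the coordinate ring of $\mathbb P^n=\mathbb P(\mathcal S_1)$. For $0\neq L\in\mathcal S_1$ let $\wp_L\subset\mathcal R$ be the homogeneous ideal of the point $[L]$; the $j$-fat point at $[L]$ is the scheme defined by $\wp_L^j$. For a $0$-dimensional (possibly empty) closed subscheme $Z\subset\mathbb P^n$ let $I(Z)\subseteq\mathcal R$ be its saturated homogeneous ideal. $Z$ is *apolar* to $F\in\mathcal S_d$ if $G\circ F=0$ for all $G\in I(Z)$; it is *irredundant* to $F$ if it is apolar to $F$ and no strict closed subscheme of $Z$ is apolar to $F$. *Natural apolar scheme.* Let $F\in\mathcal S_d$ and $0\ne L\in\mathcal S_1$. Complete $L$ to a basis $L_0=L,L_1,\dots,L_n$ of $\mathcal S_1$, with dual basis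 $M_0,\dots,M_n$ of $\mathcal R_1$, write $F=\sum_{|\alpha|=d}c_\alpha L_0^{\alpha_0}\cdots L_n^{\alpha_n}$ and put $f_L=\sum_\alpha \alpha!\,c_\alpha\, x_1^{[\alpha_1]}\cdots x_n^{[\alpha_n]}$. Let $\Bbbk[y_1,\dots,y_n]$ act on divided powers by contraction, $y^\beta x^{[\alpha]}=x^{[\alpha-\beta]}$ if $\beta\le\alpha$ and $0$ otherwise, and let $J$ be the annihilator of $f_L$. Then $Z_{F,L}\subset\mathbb P^n$ is the scheme whose ideal $I(Z_{F,L})$ is obtained from the homogenization of $J$ with respect to $Y_0$ by the substitution $Y_i\mapsto M_i$; it does not depend on the choice of the basis. *GAD.* A generalized additive decomposition (GAD) of $F\in\mathcal S_d$ is an expression $F=\sum_{i=1}^sL_i^{d-k_i}G_i$ with $s\ge0$, pairwise non-proportional nonzero $L_i\in\mathcal S_1$, $0\le k_i\le d$, and $G_i\in\mathcal S_{k_i}$ not divisible by $L_i$. It *evinces* the scheme $Z=\bigcup_iZ_{L_i^{d-k_i}G_i,\,L_i}$, that is, $I(Z)=\bigcap_iI(Z_{L_i^{d-k_i}G_i,\,L_i})$.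 **Proposition.** Let $Z\subset\mathbb P^n$ be a $0$-dimensional scheme apolar and irredundant to $F\in\mathcal S_d$. The following are equivalent: 1. $Z$ is evinced by a GAD of $F$; 2. there are $s\ge0$ and nonzero $L_1,\dots,L_s\in\mathcal S_1$ such that $I(Z)\supseteq\bigcap_{i=1}^s\wp_{L_i}^{d+1}$; 3. every connected component of $Z$ is contained in a $(d+1)$-fat point; that is, for every minimal prime $P$ of $I(Z)$ there is a nonzero $L\in\mathcal S_1$ such that the $P$-primary component of $I(Z)$ contains $\wp_L^{d+1}$. (An empty intersection is $\mathcal R$, so that $F=0$ with $Z=\emptyset$ is included.) -/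

import Mathlib

open MvPolynomial

noncomputable section

namespace Apolarity

/-! ### Apolarity action, divided powers, contraction

Forms of `S = k[X_0, …, X_n]` and differential operators of `R = k[Y_0, …, Y_n]` are both elements of
`MvPolynomial (Fin (n + 1)) k`; the binders say which role is meant. -/

/-- The apolarity action (differentiation): the bilinear extension of
`Y^β ∘ X^α = α! / (α - β)! X^(α - β)` if `β ≤ α`, and `0` otherwise. -/
def diffAct {k : Type*} [Field k] {m : ℕ} (G F : MvPolynomial (Fin m) k) : MvPolynomial (Fin m) k :=
  ∑ β ∈ G.support, ∑ α ∈ F.support,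
    if β ≤ α then
      monomial (α - β) (coeff β G * coeff α F * ((∏ i, (α i).descFactorial (β i) : ℕ) : k))
    else 0

/-- The contraction action of `R` on divided powers. An element of the divided power ring is
encoded by its coefficients in the divided power basis: `monomial α c` stands for `c X^[α]`. With
this encoding `Y^β` sends `X^[α]` to `X^[α - β]` if `β ≤ α` and to `0` otherwise. -/
def contract {k : Type*} [Field k] {m : ℕ} (g f : MvPolynomial (Fin m) k) :
    MvPolynomial (Fin m) k :=
  ∑ β ∈ g.support, coeff β g • f.divMonomial β

/-- `F_dp`: the polynomial `F` written in the divided power basis `X^[α] = X^α / α!`. -/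
def toDP {k : Type*} [Field k] {m : ℕ} (F : MvPolynomial (Fin m) k) : MvPolynomial (Fin m) k :=
  ∑ α ∈ F.support, monomial α (((∏ i, (α i).factorial : ℕ) : k) * coeff α F)

theorem coeff_contract {k : Type*} [Field k] {m : ℕ} (g f : MvPolynomial (Fin m) k)
    (γ : Fin m →₀ ℕ) :
    coeff γ (contract g f) = ∑ β ∈ g.support, coeff β g * coeff (β + γ) f := by
  simp [contract, coeff_sum, coeff_divMonomial]

theorem contract_eq_sum {k : Type*} [Field k] {m : ℕ} (g f : MvPolynomial (Fin m) k)
    (s : Finset (Fin m →₀ ℕ)) (hs : g.support ⊆ s) :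
    contract g f = ∑ β ∈ s, coeff β g • f.divMonomial β := by
  unfold contract
  refine Finset.sum_subset hs fun β _ hβ => ?_
  rw [notMem_support_iff.1 hβ, zero_smul]

theorem contract_add_left {k : Type*} [Field k] {m : ℕ} (g h f : MvPolynomial (Fin m) k) :
    contract (g + h) f = contract g f + contract h f := by
  classical
  rw [contract_eq_sum (g + h) f (g.support ∪ h.support) support_add,
    contract_eq_sum g f (g.support ∪ h.support) Finset.subset_union_left,
    contract_eq_sum h f (g.support ∪ h.support) Finset.subset_union_right,
    ← Finset.sum_add_distrib]
  exact Finset.sum_congr rfl fun β _ => by rw [coeff_add, add_smul]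

theorem contract_zero_left {k : Type*} [Field k] {m : ℕ} (f : MvPolynomial (Fin m) k) :
    contract 0 f = 0 := by
  simp [contract]

theorem contract_zero_right {k : Type*} [Field k] {m : ℕ} (g : MvPolynomial (Fin m) k) :
    contract g 0 = 0 := by
  simp [contract]

theorem contract_monomial_left {k : Type*} [Field k] {m : ℕ} (β : Fin m →₀ ℕ) (c : k)
    (f : MvPolynomial (Fin m) k) : contract (monomial β c) f = c • f.divMonomial β := by
  classical
  rw [contract_eq_sum _ _ {β} support_monomial_subset]
  simp

theorem monomial_mul_contract {k : Type*} [Field k] {m : ℕ} (β : Fin m →₀ ℕ) (c : k)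
    (g f : MvPolynomial (Fin m) k) :
    contract (monomial β c * g) f = contract (monomial β c) (contract g f) := by
  induction g using MvPolynomial.induction_on' with
  | monomial γ b =>
    rw [monomial_mul, contract_monomial_left, contract_monomial_left, contract_monomial_left,
      add_comm β γ, divMonomial_add]
    ext δ
    simp [coeff_divMonomial, mul_assoc]
  | add p q hp hq =>
    rw [mul_add, contract_add_left, hp, hq, contract_add_left, contract_monomial_left,
      contract_monomial_left, contract_monomial_left, add_divMonomial, smul_add]

theorem mul_contract {k : Type*} [Field k] {m : ℕ} (h g f : MvPolynomial (Fin m) k) :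
    contract (h * g) f = contract h (contract g f) := by
  induction h using MvPolynomial.induction_on' with
  | monomial β c => exact monomial_mul_contract β c g f
  | add p q hp hq => rw [add_mul, contract_add_left, hp, hq, contract_add_left]

/-- The annihilator of `f` for the contraction action. -/
def contractAnn {k : Type*} [Field k] {m : ℕ} (f : MvPolynomial (Fin m) k) :
    Ideal (MvPolynomial (Fin m) k) where
  carrier := {g | contract g f = 0}
  zero_mem' := contract_zero_left f
  add_mem' := fun {a b} ha hb => by
    rw [Set.mem_ofPred_eq] at ha hb ⊢
    rw [contract_add_left, ha, hb, add_zero]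
  smul_mem' := fun c a ha => by
    rw [Set.mem_ofPred_eq] at ha ⊢
    rw [smul_eq_mul, mul_contract, ha, contract_zero_right]

/-! ### Zero-dimensional subschemes of projective space -/

attribute [local instance] MvPolynomial.gradedAlgebra

/-- A closed subscheme of `ℙ^n` of dimension at most `0` (the empty scheme is included), given by
its saturated homogeneous ideal `I(Z)` in the coordinate ring `R = k[Y_0, …, Y_n]`. -/
structure ZeroDimScheme (k : Type*) [Field k] (n : ℕ) where
  /-- The ideal `I(Z)`. -/
  ideal : Ideal (MvPolynomial (Fin (n + 1)) k)
  homogeneous : ideal.IsHomogeneous (homogeneousSubmodule (Fin (n + 1)) k)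
  /-- Saturation: `(I(Z) : (Y_0, …, Y_n)) = I(Z)`. -/
  saturated : ∀ G : MvPolynomial (Fin (n + 1)) k, (∀ i, X i * G ∈ ideal) → G ∈ ideal
  /-- The affine cone has dimension at most `1`. -/
  dim_le : ringKrullDim (MvPolynomial (Fin (n + 1)) k ⧸ ideal) ≤ 1

/-- `Z` is apolar to `F`: `I(Z) ⊆ Ann(F)`, where `Ann(F) = {G | G ∘ F = 0}`. -/
def IsApolar {k : Type*} [Field k] {n : ℕ} (Z : ZeroDimScheme k n)
    (F : MvPolynomial (Fin (n + 1)) k) : Prop :=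
  ∀ G ∈ Z.ideal, diffAct G F = 0

/-- `Z' ⊆ Z` as closed subschemes of `ℙ^n`. -/
def IsSubscheme {k : Type*} [Field k] {n : ℕ} (Z' Z : ZeroDimScheme k n) : Prop :=
  Z.ideal ≤ Z'.ideal

/-- `Z` is apolar to `F`, and no strict subscheme of `Z` is apolar to `F`. -/
def IsIrredundant {k : Type*} [Field k] {n : ℕ} (Z : ZeroDimScheme k n)
    (F : MvPolynomial (Fin (n + 1)) k) : Prop :=
  IsApolar Z F ∧ ∀ Z' : ZeroDimScheme k n, IsSubscheme Z' Z → IsApolar Z' F → Z' = Z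

/-- The ideal of the connected component of `Z` at the point given by the minimal prime `P` of
`I(Z)`: the `P`-primary component of `I(Z)`, i.e. the contraction of `I(Z) R_P`. -/
def componentIdeal {k : Type*} [Field k] {n : ℕ} (Z : ZeroDimScheme k n)
    (P : Ideal (MvPolynomial (Fin (n + 1)) k)) [P.IsPrime] :
    Ideal (MvPolynomial (Fin (n + 1)) k) :=
  (Z.ideal.map (algebraMap _ (Localization.AtPrime P))).comap
    (algebraMap _ (Localization.AtPrime P))

/-! ### Points and linear forms -/

/-- The linear form `a_0 X_0 + … + a_n X_n`. -/
def linForm {k : Type*} [Field k] {n : ℕ} (a : Fin (n + 1) → k) : MvPolynomial (Fin (n + 1)) k :=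
  ∑ i, C (a i) * X i

/-- The coefficient vector of a linear form. -/
def coeffVec {k : Type*} [Field k] {n : ℕ} (L : MvPolynomial (Fin (n + 1)) k) : Fin (n + 1) → k :=
  fun i => coeff (Finsupp.single i 1) L

/-- `℘_L`: the homogeneous ideal in `R` of the point `[L] ∈ ℙ^n = ℙ(S_1)`. -/
def pointIdeal {k : Type*} [Field k] {n : ℕ} (L : MvPolynomial (Fin (n + 1)) k) :
    Ideal (MvPolynomial (Fin (n + 1)) k) :=
  Ideal.span {G | (∃ e, G.IsHomogeneous e) ∧ eval (coeffVec L) G = 0}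

theorem linForm_coeffVec {k : Type*} [Field k] {n : ℕ} (L : MvPolynomial (Fin (n + 1)) k)
    (hL : L.IsHomogeneous 1) : linForm (coeffVec L) = L := by
  classical
  ext α
  simp only [linForm, coeffVec, coeff_sum, coeff_C_mul, coeff_X, mul_ite, mul_one, mul_zero]
  by_cases hα : α.degree = 1
  · obtain ⟨i, rfl⟩ := (Finsupp.sum_eq_one_iff α).1 hα
    rw [Finset.sum_eq_single i]
    · simp
    · intro j _ hj
      rw [if_neg]
      intro h
      exact hj ((Finsupp.single_left_inj one_ne_zero).1 h)
    · simp
  · rw [hL.coeff_eq_zero hα]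
    refine Finset.sum_eq_zero fun i _ => ?_
    rw [if_neg]
    rintro rfl
    exact hα (by simp)

/-- A nonzero linear form is the first element of a basis `L_0 = L, L_1, …, L_n` of `S_1`, the rows
of an invertible matrix. -/
theorem exists_coords {k : Type*} [Field k] {n : ℕ} (L : MvPolynomial (Fin (n + 1)) k)
    (hL : L.IsHomogeneous 1) (hL0 : L ≠ 0) :
    ∃ A : Matrix.GeneralLinearGroup (Fin (n + 1)) k, linForm (A.1 0) = L := by
  classical
  obtain ⟨j, hj⟩ : ∃ j, coeffVec L j ≠ 0 := by
    by_contra! h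
    apply hL0
    rw [← linForm_coeffVec L hL]
    simp [linForm, h]
  let M : Matrix (Fin (n + 1)) (Fin (n + 1)) k :=
    Matrix.of (Fin.cons (coeffVec L) fun i => Pi.single (j.succAbove i) 1)
  have hM : M.det ≠ 0 := by
    intro h
    obtain ⟨v, hv, hMv⟩ := Matrix.exists_mulVec_eq_zero_iff.2 h
    have h1 : ∀ i, v (j.succAbove i) = 0 := fun i => by
      have := congrFun hMv i.succ
      simpa [M, Matrix.mulVec, dotProduct, Pi.single_apply] using this
    have h2 : v j = 0 := by
      have := congrFun hMv 0
      simp only [M, Matrix.mulVec, dotProduct, Matrix.of_apply, Fin.cons_zero, Pi.zero_apply] at this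
      rw [Fin.sum_univ_succAbove _ j] at this
      simpa [h1, hj] using this
    apply hv
    funext i
    rcases Fin.eq_self_or_eq_succAbove j i with rfl | ⟨i', rfl⟩
    · exact h2
    · exact h1 i'
  refine ⟨Matrix.GeneralLinearGroup.mkOfDetNeZero M hM, ?_⟩
  exact linForm_coeffVec L hL

/-! ### Natural apolar schemes

Coordinates are given by an invertible matrix `A` whose rows are the coefficient vectors of a basis
`L_0, …, L_n` of `S_1`. -/

/-- `F` rewritten in the coordinates `L_0, …, L_n`, i.e. the `F'` with `F = F'(L_0, …, L_n)`. -/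
def changeCoords {k : Type*} [Field k] {n : ℕ} (A : Matrix.GeneralLinearGroup (Fin (n + 1)) k)
    (F : MvPolynomial (Fin (n + 1)) k) : MvPolynomial (Fin (n + 1)) k :=
  aeval (fun i => linForm ((A⁻¹).1 i)) F

/-- The contragredient change of coordinates of `R`: it sends `Y_i` to the `i`-th element of the
basis of `R_1` that is dual to `L_0, …, L_n`. -/
def dualCoords {k : Type*} [Field k] {n : ℕ} (A : Matrix.GeneralLinearGroup (Fin (n + 1)) k) :
    MvPolynomial (Fin (n + 1)) k →ₐ[k] MvPolynomial (Fin (n + 1)) k :=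
  aeval fun i => linForm fun j => (A⁻¹).1 j i

/-- The dehomogenization `X_0^[a] ↦ 1` (`X_i ↦ x_i` for `i ≥ 1`) in the divided power basis. -/
def dehom {k : Type*} [Field k] {n : ℕ} (F : MvPolynomial (Fin (n + 1)) k) :
    MvPolynomial (Fin n) k :=
  aeval (Fin.cons 1 X : Fin (n + 1) → MvPolynomial (Fin n) k) F

/-- The homogenization of `g ∈ k[y_1, …, y_n]` with respect to `Y_0`. -/
def homog {k : Type*} [Field k] {n : ℕ} (g : MvPolynomial (Fin n) k) :
    MvPolynomial (Fin (n + 1)) k :=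
  ∑ β ∈ g.support, monomial (Finsupp.cons (g.totalDegree - β.degree) β) (coeff β g)

/-- The homogenization of an ideal of `k[y_1, …, y_n]`. -/
def homogIdeal {k : Type*} [Field k] {n : ℕ} (J : Ideal (MvPolynomial (Fin n) k)) :
    Ideal (MvPolynomial (Fin (n + 1)) k) :=
  Ideal.span (homog '' (J : Set (MvPolynomial (Fin n) k)))

/-- The ideal of the natural apolar scheme to `F` supported at `L_0`, computed in the coordinates
`L_0, …, L_n`: dehomogenize `F_dp` by `L_0`, take the annihilator by contraction, homogenize, and
return to the original coordinates. -/
def naturalApolarIdealIn {k : Type*} [Field k] {n : ℕ}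
    (A : Matrix.GeneralLinearGroup (Fin (n + 1)) k) (F : MvPolynomial (Fin (n + 1)) k) :
    Ideal (MvPolynomial (Fin (n + 1)) k) :=
  (homogIdeal (contractAnn (dehom (toDP (changeCoords A F))))).map (dualCoords A)

open Classical in
/-- The ideal `I(Z_{F,L})` of the natural apolar scheme to `F` supported at `[L]`, computed in a
basis of `S_1` whose first element is `L` (the choice of the basis is arbitrary and immaterial; such
a basis exists for every nonzero linear form, see `exists_coords`). -/
def naturalApolarIdeal {k : Type*} [Field k] {n : ℕ} (F L : MvPolynomial (Fin (n + 1)) k) :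
    Ideal (MvPolynomial (Fin (n + 1)) k) :=
  if h : ∃ A : Matrix.GeneralLinearGroup (Fin (n + 1)) k, linForm (A.1 0) = L then
    naturalApolarIdealIn h.choose F
  else ⊤

/-! ### Generalized additive decompositions -/

/-- A generalized additive decomposition `F = ∑ L_i^(d - k_i) G_i` of `F ∈ S_d`. -/
structure GAD {k : Type*} [Field k] {n : ℕ} (d : ℕ) (F : MvPolynomial (Fin (n + 1)) k) where
  /-- The number of summands. -/
  s : ℕ
  /-- The linear forms `L_i`. -/
  L : Fin s → MvPolynomial (Fin (n + 1)) k
  /-- The degrees `k_i`. -/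
  deg : Fin s → ℕ
  /-- The forms `G_i`. -/
  G : Fin s → MvPolynomial (Fin (n + 1)) k
  L_homogeneous : ∀ i, (L i).IsHomogeneous 1
  L_ne_zero : ∀ i, L i ≠ 0
  L_not_proportional : ∀ i j, i ≠ j → ∀ c : k, L i ≠ c • L j
  deg_le : ∀ i, deg i ≤ d
  G_homogeneous : ∀ i, (G i).IsHomogeneous (deg i)
  not_dvd : ∀ i, ¬ L i ∣ G i
  sum_eq : F = ∑ i, L i ^ (d - deg i) * G i

/-- `Z` is the scheme evinced by the decomposition: the union of the natural apolar schemes to the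
summands `L_i^(d - k_i) G_i` supported at `[L_i]`. -/
def IsEvincedBy {k : Type*} [Field k] {n d : ℕ} {F : MvPolynomial (Fin (n + 1)) k}
    (Z : ZeroDimScheme k n) (D : GAD d F) : Prop :=
  Z.ideal = ⨅ i, naturalApolarIdeal (D.L i ^ (d - D.deg i) * D.G i) (D.L i)

end Apolarity

end

/-!
Passing to divided powers turns the apolarity action into contraction, so that `Z` is apolar to `F`
exactly when `I(Z)` annihilates `F_dp`, and the orthogonal space of a finite intersection of ideals
is the sum of their orthogonal spaces.

Fat points lie in natural apolar ideals because polynomials of degree at most `d` in `n` variables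
are killed by all operators of degree `d + 1`; this is the passage from decompositions to
intersections of fat points. Localizing such an intersection at a component of `Z` leaves the only
fat point whose support lies on it.

Conversely, if each component `Q_P` of `I(Z)` contains `℘_P ^ (d + 1)`, then `Z` is supported at the
points `℘_P`, so `I(Z) = ⋂ Q_P` and `F = ∑ F_P` with `Q_P` orthogonal to the form `F_P`. The natural
apolar ideal of `F_P` is the largest homogeneous ideal that contains `℘_P ^ (d + 1)`, is saturated
with respect to linear forms not vanishing at the point, and is orthogonal to `F_P`; it thus
contains `Q_P`. The intersection of these ideals contains `I(Z)` and is apolar to `F`, so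
irredundancy makes it equal to `I(Z)`. Splitting off from each nonzero `F_P` the largest power of
its linear form gives the generalized additive decomposition.
-/

noncomputable section

namespace Apolarity

attribute [local instance] MvPolynomial.gradedAlgebra

/-! ### Differentiation and contraction -/

section Action

variable {k : Type*} [Field k] {m : ℕ}

theorem coeff_diffAct (G F : MvPolynomial (Fin m) k) (γ : Fin m →₀ ℕ) :
    coeff γ (diffAct G F) = ∑ β ∈ G.support,
      coeff β G * coeff (β + γ) F * ((∏ i, ((β + γ) i).descFactorial (β i) : ℕ) : k) := by
  classical
  simp only [diffAct, coeff_sum]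
  refine Finset.sum_congr rfl fun β _ => ?_
  rw [Finset.sum_eq_single (β + γ)]
  · rw [if_pos le_self_add, coeff_monomial, if_pos (add_tsub_cancel_left β γ)]
  · intro α _ hα
    split_ifs with hle
    · rw [coeff_monomial, if_neg fun h => hα (by rw [← h, add_tsub_cancel_of_le hle])]
    · exact coeff_zero _
  · intro hn
    simp [notMem_support_iff.1 hn]

theorem coeff_diffAct_monomial (β : Fin m →₀ ℕ) (c : k) (F : MvPolynomial (Fin m) k)
    (γ : Fin m →₀ ℕ) : coeff γ (diffAct (monomial β c) F) =
      c * coeff (β + γ) F * ((∏ i, ((β + γ) i).descFactorial (β i) : ℕ) : k) := by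
  classical
  rw [coeff_diffAct, Finset.sum_subset support_monomial_subset (by simp_all), Finset.sum_singleton,
    coeff_monomial, if_pos rfl]

theorem diffAct_add_left (G H F : MvPolynomial (Fin m) k) :
    diffAct (G + H) F = diffAct G F + diffAct H F := by
  ext γ
  simp only [coeff_add, coeff_diffAct]
  exact Finsupp.sum_add_index' (h := fun β b => b * coeff (β + γ) F * _) (by simp)
    (fun _ _ _ => by ring)

theorem diffAct_C (c : k) (F : MvPolynomial (Fin m) k) : diffAct (C c) F = C c * F := by
  ext γ
  rw [← monomial_zero', coeff_diffAct_monomial]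
  simp

theorem diffAct_X (i : Fin m) (F : MvPolynomial (Fin m) k) : diffAct (X i) F = pderiv i F := by
  classical
  ext γ
  rw [X, coeff_diffAct_monomial, coeff_pderiv, add_comm γ, Finset.prod_eq_single i]
  · simp [add_comm]
  · intro j _ hj
    simp [Finsupp.single_eq_of_ne hj]
  · simp

theorem coeff_sum_monomial_mul (c : (Fin m →₀ ℕ) → k) (F : MvPolynomial (Fin m) k)
    (γ : Fin m →₀ ℕ) :
    coeff γ (∑ α ∈ F.support, monomial α (c α * coeff α F)) = c γ * coeff γ F := by
  classical
  simp only [coeff_sum, coeff_monomial]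
  rw [Finset.sum_ite_eq' F.support γ, ite_eq_left_iff]
  intro h
  rw [notMem_support_iff.1 h, mul_zero]

theorem coeff_toDP (F : MvPolynomial (Fin m) k) (γ : Fin m →₀ ℕ) :
    coeff γ (toDP F) = ((∏ i, (γ i).factorial : ℕ) : k) * coeff γ F :=
  coeff_sum_monomial_mul _ F γ

theorem toDP_zero : toDP (0 : MvPolynomial (Fin m) k) = 0 := by
  simp [toDP]

theorem toDP_add (F G : MvPolynomial (Fin m) k) : toDP (F + G) = toDP F + toDP G := by
  ext γ
  simp [coeff_toDP, mul_add]

theorem toDP_isHomogeneous {F : MvPolynomial (Fin m) k} {d : ℕ} (hF : F.IsHomogeneous d) :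
    (toDP F).IsHomogeneous d :=
  fun γ hγ => hF fun h => hγ (by rw [coeff_toDP, h, mul_zero])

theorem toDP_diffAct (G F : MvPolynomial (Fin m) k) :
    toDP (diffAct G F) = contract G (toDP F) := by
  ext γ
  rw [coeff_toDP, coeff_diffAct, coeff_contract, Finset.mul_sum]
  refine Finset.sum_congr rfl fun β _ => ?_
  have factorial_eq : (∏ i, (γ i).factorial) * ∏ i, ((β + γ) i).descFactorial (β i) =
      ∏ i, ((β + γ) i).factorial := by
    rw [← Finset.prod_mul_distrib]
    refine Finset.prod_congr rfl fun i _ => ?_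
    have := Nat.factorial_mul_descFactorial (n := (β + γ) i) (k := β i) (by simp)
    rwa [Finsupp.add_apply, Nat.add_sub_cancel_left] at this
  rw [coeff_toDP, ← factorial_eq, Nat.cast_mul]
  ring

section CharZero

variable [CharZero k]

theorem prod_factorial_ne_zero (γ : Fin m →₀ ℕ) : ((∏ i, (γ i).factorial : ℕ) : k) ≠ 0 :=
  Nat.cast_ne_zero.2 (Finset.prod_ne_zero_iff.2 fun _ _ => Nat.factorial_ne_zero _)

theorem toDP_injective :
    Function.Injective (toDP : MvPolynomial (Fin m) k → MvPolynomial (Fin m) k) := by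
  intro F G h
  ext γ
  have := congrArg (coeff γ) h
  rw [coeff_toDP, coeff_toDP] at this
  exact mul_left_cancel₀ (prod_factorial_ne_zero γ) this

theorem exists_toDP_eq {f : MvPolynomial (Fin m) k} {d : ℕ} (hf : f.IsHomogeneous d) :
    ∃ F : MvPolynomial (Fin m) k, F.IsHomogeneous d ∧ toDP F = f := by
  let F : MvPolynomial (Fin m) k :=
    ∑ α ∈ f.support, monomial α (((∏ i, (α i).factorial : ℕ) : k)⁻¹ * coeff α f)
  have coeff_F (γ) : coeff γ F = ((∏ i, (γ i).factorial : ℕ) : k)⁻¹ * coeff γ f :=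
    coeff_sum_monomial_mul _ f γ
  refine ⟨F, fun γ hγ => hf fun h => hγ (by rw [coeff_F, h, mul_zero]), ?_⟩
  ext γ
  rw [coeff_toDP, coeff_F, mul_inv_cancel_left₀ (prod_factorial_ne_zero γ)]

theorem diffAct_eq_zero_iff (G F : MvPolynomial (Fin m) k) :
    diffAct G F = 0 ↔ G ∈ contractAnn (toDP F) := by
  rw [← toDP_injective.eq_iff, toDP_diffAct, toDP_zero]
  rfl

theorem diffAct_mul (G H F : MvPolynomial (Fin m) k) :
    diffAct (G * H) F = diffAct G (diffAct H F) :=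
  toDP_injective (by simp only [toDP_diffAct, mul_contract])

end CharZero

/-- The pairing `(g, f) ↦ (g f)(0)` between `k[y_1, …, y_m]` and the divided power ring, given by
contraction. It restricts to a perfect pairing in each degree. -/
def contractPairing :
    MvPolynomial (Fin m) k →ₗ[k] MvPolynomial (Fin m) k →ₗ[k] k :=
  LinearMap.mk₂ k (fun g f => coeff 0 (contract g f))
    (fun g h f => by rw [contract_add_left, coeff_add])
    (fun c g f => by
      rw [smul_eq_C_mul, mul_contract, ← monomial_zero', contract_monomial_left, divMonomial_zero,
        coeff_smul])
    (fun g f f' => by simp [coeff_contract, mul_add, Finset.sum_add_distrib])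
    (fun c g f => by simp [coeff_contract, mul_left_comm, Finset.mul_sum])

theorem contractPairing_apply (g f : MvPolynomial (Fin m) k) :
    contractPairing g f = coeff 0 (contract g f) := rfl

theorem contractPairing_eq_sum (g f : MvPolynomial (Fin m) k) :
    contractPairing g f = ∑ β ∈ g.support, coeff β g * coeff β f := by
  simp [contractPairing_apply, coeff_contract]

theorem contractPairing_monomial_mul (g f : MvPolynomial (Fin m) k) (γ : Fin m →₀ ℕ) :
    contractPairing (monomial γ 1 * g) f = coeff γ (contract g f) := by
  rw [contractPairing_apply, mul_contract, contract_monomial_left, one_smul, coeff_divMonomial,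
    add_zero]

theorem contractPairing_monomial (f : MvPolynomial (Fin m) k) (γ : Fin m →₀ ℕ) (c : k) :
    contractPairing (monomial γ c) f = c * coeff γ f := by
  rw [contractPairing_apply, contract_monomial_left, coeff_smul, coeff_divMonomial, add_zero,
    smul_eq_mul]

theorem contractPairing_homogeneousComponent (g : MvPolynomial (Fin m) k)
    {f : MvPolynomial (Fin m) k} {d : ℕ} (hf : f.IsHomogeneous d) :
    contractPairing (homogeneousComponent d g) f = contractPairing g f := by
  classical
  have support_subset : (homogeneousComponent d g).support ⊆ g.support := fun β hβ => by
    rw [mem_support_iff, coeff_homogeneousComponent] at hβ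
    exact mem_support_iff.2 (ite_ne_right_iff.1 hβ).2
  rw [contractPairing_eq_sum, contractPairing_eq_sum,
    Finset.sum_subset support_subset fun β _ hβ => by rw [notMem_support_iff.1 hβ, zero_mul]]
  refine Finset.sum_congr rfl fun β _ => ?_
  rw [coeff_homogeneousComponent]
  split_ifs with hβ
  · rfl
  · rw [hf.coeff_eq_zero hβ, mul_zero, mul_zero]

theorem mem_contractAnn {g f : MvPolynomial (Fin m) k} : g ∈ contractAnn f ↔ contract g f = 0 :=
  Iff.rfl

theorem contractPairing_eq_zero {g f : MvPolynomial (Fin m) k} (h : g ∈ contractAnn f) :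
    contractPairing g f = 0 := by
  rw [contractPairing_apply, mem_contractAnn.1 h, coeff_zero]

theorem le_contractAnn {J : Ideal (MvPolynomial (Fin m) k)} {f : MvPolynomial (Fin m) k}
    (h : ∀ g ∈ J, contractPairing g f = 0) : J ≤ contractAnn f := by
  refine fun g hg => mem_contractAnn.2 ?_
  ext γ
  rw [← contractPairing_monomial_mul, coeff_zero]
  exact h _ (J.mul_mem_left _ hg)

theorem le_contractAnn_of_isHomogeneous {J : Ideal (MvPolynomial (Fin m) k)}
    (hJ : J.IsHomogeneous (homogeneousSubmodule (Fin m) k)) {f : MvPolynomial (Fin m) k} {d : ℕ}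
    (hf : f.IsHomogeneous d) (h : ∀ g ∈ J, g.IsHomogeneous d → contractPairing g f = 0) :
    J ≤ contractAnn f := by
  refine le_contractAnn fun g hg => ?_
  rw [← contractPairing_homogeneousComponent g hf]
  exact h _ (homogeneousComponent_mem_of_mem hJ hg d) (homogeneousComponent_isHomogeneous d g)

theorem idealOfVars_pow_le_contractAnn {f : MvPolynomial (Fin m) k} {d : ℕ}
    (hf : f.totalDegree ≤ d) : idealOfVars (Fin m) k ^ (d + 1) ≤ contractAnn f := by
  refine le_contractAnn fun g hg => ?_
  rw [contractPairing_eq_sum]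
  refine Finset.sum_eq_zero fun β hβ => ?_
  have : f.totalDegree < β.degree := hf.trans_lt ((mem_pow_idealOfVars_iff _ _).1 hg β hβ)
  rw [coeff_eq_zero_of_totalDegree_lt this, mul_zero]

end Action

/-! ### Linear changes of coordinates -/

section Coordinates

variable {k : Type*} [Field k] {n : ℕ}

theorem linForm_isHomogeneous (a : Fin (n + 1) → k) : (linForm a).IsHomogeneous 1 :=
  IsHomogeneous.sum _ _ _ fun i _ => isHomogeneous_C_mul_X (a i) i

theorem coeffVec_linForm (a : Fin (n + 1) → k) : coeffVec (linForm a) = a := by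
  classical
  funext i
  simp [coeffVec, linForm, coeff_sum, coeff_C_mul, coeff_X, Finsupp.single_left_inj]

/-- The linear substitution `X_i ↦ M_{i0} X_0 + … + M_{in} X_n` attached to a square matrix `M`.
Both `changeCoords A` and `dualCoords A` are of this form, for `A⁻¹` and its transpose. -/
def linSubst (M : Matrix (Fin (n + 1)) (Fin (n + 1)) k) :
    MvPolynomial (Fin (n + 1)) k →ₐ[k] MvPolynomial (Fin (n + 1)) k :=
  aeval fun i => linForm (M i)

variable (M N : Matrix (Fin (n + 1)) (Fin (n + 1)) k)

theorem linSubst_isHomogeneous {F : MvPolynomial (Fin (n + 1)) k} {d : ℕ}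
    (hF : F.IsHomogeneous d) : (linSubst M F).IsHomogeneous d := by
  simpa only [one_mul, linSubst] using hF.aeval _ fun i => linForm_isHomogeneous (M i)

theorem comap_linSubst_isHomogeneous {I : Ideal (MvPolynomial (Fin (n + 1)) k)}
    (hI : I.IsHomogeneous (homogeneousSubmodule (Fin (n + 1)) k)) :
    (I.comap (linSubst M)).IsHomogeneous (homogeneousSubmodule (Fin (n + 1)) k) :=
  let linSubstGraded :
      homogeneousSubmodule (Fin (n + 1)) k →+*ᵍ homogeneousSubmodule (Fin (n + 1)) k :=
    { (linSubst M).toRingHom with map_mem := fun h => linSubst_isHomogeneous M h }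
  (HomogeneousIdeal.comap linSubstGraded ⟨I, hI⟩).isHomogeneous

theorem linSubst_linForm (a : Fin (n + 1) → k) :
    linSubst M (linForm a) = linForm (Matrix.vecMul a M) := by
  simp only [linSubst, linForm, map_sum, map_mul, algHom_C, algebraMap_eq, aeval_X, Finset.mul_sum,
    Matrix.vecMul, dotProduct, Finset.sum_mul, mul_assoc]
  exact Finset.sum_comm

theorem linSubst_linSubst (F : MvPolynomial (Fin (n + 1)) k) :
    linSubst M (linSubst N F) = linSubst (N * M) F := by
  suffices (linSubst M).comp (linSubst N) = linSubst (N * M) from DFunLike.congr_fun this F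
  ext1 i
  rw [AlgHom.comp_apply, linSubst, linSubst, linSubst, aeval_X, aeval_X]
  exact linSubst_linForm M (N i)

theorem linSubst_one (F : MvPolynomial (Fin (n + 1)) k) :
    linSubst (1 : Matrix (Fin (n + 1)) (Fin (n + 1)) k) F = F := by
  suffices linSubst (1 : Matrix (Fin (n + 1)) (Fin (n + 1)) k) = AlgHom.id k _ from
    DFunLike.congr_fun this F
  ext1 i
  simp [linSubst, linForm, Matrix.one_apply]

theorem eval_linSubst (a : Fin (n + 1) → k) (F : MvPolynomial (Fin (n + 1)) k) :
    eval a (linSubst M F) = eval (M.mulVec a) F := by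
  suffices (aeval a).comp (linSubst M) = aeval (M.mulVec a) by
    simpa only [AlgHom.comp_apply, aeval_eq_eval] using DFunLike.congr_fun this F
  ext1 i
  simp [linSubst, linForm, Matrix.mulVec, dotProduct]

theorem diffAct_linForm [CharZero k] (a : Fin (n + 1) → k) (F : MvPolynomial (Fin (n + 1)) k) :
    diffAct (linForm a) F = ∑ i, C (a i) * pderiv i F := by
  calc diffAct (linForm a) F = ∑ i, diffAct (C (a i) * X i) F :=
        map_sum (AddMonoidHom.mk' (diffAct · F) (diffAct_add_left · · F)) _ _
    _ = ∑ i, C (a i) * pderiv i F := by simp only [diffAct_mul, diffAct_X, diffAct_C]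

theorem pderiv_linSubst (i : Fin (n + 1)) (F : MvPolynomial (Fin (n + 1)) k) :
    pderiv i (linSubst M F) = linSubst M (∑ j, C (M j i) * pderiv j F) := by
  classical
  have pderiv_linForm (a : Fin (n + 1) → k) : pderiv i (linForm a) = C (a i) := by
    simp [linForm, pderiv_X, Pi.single_apply]
  induction F using MvPolynomial.induction_on with
  | C a => simp [linSubst]
  | add p q hp hq => simp only [map_add, hp, hq, mul_add, Finset.sum_add_distrib]
  | mul_X p j hp =>
    have hX : pderiv i (linSubst M (X j)) = C (M j i) := by
      rw [linSubst, aeval_X, pderiv_linForm]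
    simp only [map_mul, Derivation.leibniz, hp, hX, smul_eq_mul, pderiv_X, map_add, mul_add,
      Finset.sum_add_distrib, algHom_C, algebraMap_eq, map_sum, Pi.single_apply, mul_ite, mul_one,
      mul_zero, Finset.sum_ite_eq, Finset.mem_univ, if_true, Finset.mul_sum]
    rw [mul_comm]
    exact congrArg _ (Finset.sum_congr rfl fun _ _ => mul_left_comm _ _ _)

theorem linSubst_diffAct_transpose [CharZero k] (G F : MvPolynomial (Fin (n + 1)) k) :
    linSubst M (diffAct (linSubst M.transpose G) F) = diffAct G (linSubst M F) := by
  induction G using MvPolynomial.induction_on generalizing F with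
  | C a => simp only [linSubst, algHom_C, algebraMap_eq, diffAct_C, map_mul]
  | add p q hp hq => rw [map_add, diffAct_add_left, map_add, hp, hq, diffAct_add_left]
  | mul_X p i hp =>
    have linSubst_X : linSubst M.transpose (X i) = linForm fun j => M j i := aeval_X _ i
    rw [map_mul, diffAct_mul, diffAct_mul, hp, diffAct_X, pderiv_linSubst, linSubst_X,
      diffAct_linForm]

variable (A : Matrix.GeneralLinearGroup (Fin (n + 1)) k)

theorem changeCoords_eq_linSubst (F : MvPolynomial (Fin (n + 1)) k) :
    changeCoords A F = linSubst (A⁻¹).1 F := rfl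

theorem dualCoords_eq_linSubst : dualCoords A = linSubst (A⁻¹).1.transpose := rfl

theorem changeCoords_isHomogeneous {F : MvPolynomial (Fin (n + 1)) k} {d : ℕ}
    (hF : F.IsHomogeneous d) : (changeCoords A F).IsHomogeneous d :=
  linSubst_isHomogeneous _ hF

theorem linSubst_changeCoords (F : MvPolynomial (Fin (n + 1)) k) :
    linSubst A.1 (changeCoords A F) = F := by
  rw [changeCoords_eq_linSubst, linSubst_linSubst, Units.inv_mul, linSubst_one]

theorem dualCoords_linSubst (G : MvPolynomial (Fin (n + 1)) k) :
    dualCoords A (linSubst A.1.transpose G) = G := by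
  rw [dualCoords_eq_linSubst, linSubst_linSubst, ← Matrix.transpose_mul, Units.inv_mul,
    Matrix.transpose_one, linSubst_one]

theorem linSubst_dualCoords (G : MvPolynomial (Fin (n + 1)) k) :
    linSubst A.1.transpose (dualCoords A G) = G := by
  rw [dualCoords_eq_linSubst, linSubst_linSubst, ← Matrix.transpose_mul, Units.mul_inv,
    Matrix.transpose_one, linSubst_one]

theorem map_dualCoords (I : Ideal (MvPolynomial (Fin (n + 1)) k)) :
    I.map (dualCoords A) = I.comap (linSubst A.1.transpose) :=
  le_antisymm
    (Ideal.map_le_iff_le_comap.2 fun G hG => by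
      rwa [Ideal.mem_comap, Ideal.mem_comap, linSubst_dualCoords])
    fun G hG => by
      rw [← dualCoords_linSubst A G]
      exact Ideal.mem_map_of_mem _ hG

theorem diffAct_dualCoords_eq_zero_iff [CharZero k] (G F : MvPolynomial (Fin (n + 1)) k) :
    diffAct (dualCoords A G) F = 0 ↔ diffAct G (changeCoords A F) = 0 := by
  rw [changeCoords_eq_linSubst, ← linSubst_diffAct_transpose, ← dualCoords_eq_linSubst,
    ← changeCoords_eq_linSubst]
  refine ⟨fun h => ?_, fun h => ?_⟩
  · rw [h, changeCoords_eq_linSubst, map_zero]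
  · rw [← linSubst_changeCoords A (diffAct _ F), h, map_zero]

end Coordinates

/-! ### Homogeneous ideals -/

section HomogeneousIdeals

variable {ι σ A : Type*} [CommSemiring A] [SetLike σ A] [AddSubmonoidClass σ A] [DecidableEq ι]

theorem le_of_forall_isHomogeneous [AddMonoid ι] {𝒜 : ι → σ} [GradedRing 𝒜] {I J : Ideal A}
    (hI : I.IsHomogeneous 𝒜) (h : ∀ i, ∀ x ∈ 𝒜 i, x ∈ I → x ∈ J) : I ≤ J := by
  classical
  intro x hx
  rw [← DirectSum.sum_support_decompose 𝒜 x]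
  exact J.sum_mem fun i _ => h i _ (SetLike.coe_mem _) (hI i hx)

theorem colon_singleton_isHomogeneous [AddRightCancelMonoid ι] {𝒜 : ι → σ} [GradedRing 𝒜]
    {I : Ideal A} (hI : I.IsHomogeneous 𝒜) {i : ι} {x : A} (hx : x ∈ 𝒜 i) :
    Ideal.IsHomogeneous 𝒜 (I.colon {x}) := by
  intro j y hy
  rw [Submodule.mem_colon_singleton, smul_eq_mul] at hy ⊢
  rw [← DirectSum.coe_decompose_mul_add_of_right_mem 𝒜 hx]
  exact hI (j + i) hy

theorem pow_isHomogeneous [AddMonoid ι] {𝒜 : ι → σ} [GradedRing 𝒜] {I : Ideal A}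
    (hI : I.IsHomogeneous 𝒜) (r : ℕ) : (I ^ r).IsHomogeneous 𝒜 := by
  induction r with
  | zero => rw [pow_zero, Ideal.one_eq_top]; exact Ideal.IsHomogeneous.top 𝒜
  | succ r ih => exact pow_succ I r ▸ ih.mul hI

end HomogeneousIdeals

theorem isHomogeneous_of_mem_minimalPrimes {ι σ A : Type*} [CommRing A] [SetLike σ A]
    [AddSubmonoidClass σ A] [AddCommMonoid ι] [LinearOrder ι] [IsOrderedCancelAddMonoid ι]
    {𝒜 : ι → σ} [GradedRing 𝒜] {I P : Ideal A} (hI : I.IsHomogeneous 𝒜)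
    (hP : P ∈ I.minimalPrimes) : P.IsHomogeneous 𝒜 := by
  have core_le := Ideal.toIdeal_homogeneousCore_le 𝒜 P
  have le_core : I ≤ (P.homogeneousCore 𝒜).toIdeal := by
    rw [← hI.toIdeal_homogeneousCore_eq_self]
    exact Ideal.homogeneousCore_mono 𝒜 hP.1.2
  rw [← core_le.antisymm (hP.2 ⟨hP.1.1.homogeneousCore, le_core⟩ core_le)]
  exact HomogeneousIdeal.isHomogeneous _

/-! ### Dehomogenization -/

section Dehomogenization

variable {k : Type*} [Field k] {n : ℕ}

theorem degree_cons (a : ℕ) (β : Fin n →₀ ℕ) : (Finsupp.cons a β).degree = a + β.degree := by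
  simp [Finsupp.degree_eq_sum, Fin.sum_univ_succ]

theorem cons_sub_degree_tail {α : Fin (n + 1) →₀ ℕ} {e : ℕ} (hα : α.degree = e) :
    Finsupp.cons (e - α.tail.degree) α.tail = α := by
  have degree_eq : α.degree = α 0 + α.tail.degree := by
    conv_lhs => rw [← Finsupp.cons_tail α, degree_cons]
  rw [← hα, degree_eq, Nat.add_sub_cancel, Finsupp.cons_tail]

/-- The dehomogenization `dehom` as a homomorphism of algebras. -/
def dehomHom : MvPolynomial (Fin (n + 1)) k →ₐ[k] MvPolynomial (Fin n) k :=
  aeval (Fin.cons 1 X : Fin (n + 1) → MvPolynomial (Fin n) k)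

theorem dehomHom_apply (G : MvPolynomial (Fin (n + 1)) k) : dehomHom G = dehom G := rfl

theorem dehomHom_monomial (α : Fin (n + 1) →₀ ℕ) (c : k) :
    dehomHom (monomial α c) = monomial α.tail c := by
  rw [dehomHom, aeval_monomial, monomial_eq, algebraMap_eq, Finsupp.prod_fintype _ _ (by simp),
    Finsupp.prod_fintype _ _ (by simp), Fin.prod_univ_succ]
  simp [Finsupp.tail_apply]

theorem dehom_X_zero_pow_mul (a : ℕ) (G : MvPolynomial (Fin (n + 1)) k) :
    dehom (X 0 ^ a * G) = dehom G := by
  rw [← dehomHom_apply, map_mul, map_pow, dehomHom, aeval_X, Fin.cons_zero, one_pow, one_mul]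
  rfl

theorem coeff_zero_dehom (G : MvPolynomial (Fin (n + 1)) k) :
    coeff 0 (dehom G) = eval (Pi.single 0 1) G := by
  suffices (aeval (0 : Fin n → k)).comp dehomHom = aeval (Pi.single 0 1) by
    simpa only [AlgHom.comp_apply, dehomHom_apply, aeval_eq_eval, eval_zero,
      constantCoeff_eq] using
      DFunLike.congr_fun this G
  ext i
  refine Fin.cases ?_ (fun i => ?_) i <;> simp [dehomHom]

theorem coeff_tail_dehom {G : MvPolynomial (Fin (n + 1)) k} {e : ℕ} (hG : G.IsHomogeneous e)
    {α : Fin (n + 1) →₀ ℕ} (hα : α.degree = e) : coeff α.tail (dehom G) = coeff α G := by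
  classical
  rw [← dehomHom_apply, ← support_sum_monomial_coeff G, map_sum, coeff_sum, coeff_sum]
  refine Finset.sum_congr rfl fun β hβ => ?_
  have degree_β : β.degree = e := (hG.degree_eq_sum_deg_support hβ).symm
  have tail_eq_iff : β.tail = α.tail ↔ β = α := by
    refine ⟨fun h => ?_, congrArg _⟩
    rw [← cons_sub_degree_tail hα, ← cons_sub_degree_tail degree_β, h]
  simp only [dehomHom_monomial, coeff_monomial, tail_eq_iff]

theorem dehom_injOn {G H : MvPolynomial (Fin (n + 1)) k} {e : ℕ}
    (hG : G.IsHomogeneous e) (hH : H.IsHomogeneous e) (h : dehom G = dehom H) : G = H := by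
  ext α
  by_cases hα : α.degree = e
  · rw [← coeff_tail_dehom hG hα, h, coeff_tail_dehom hH hα]
  · rw [hG.coeff_eq_zero hα, hH.coeff_eq_zero hα]

theorem totalDegree_dehom_le {G : MvPolynomial (Fin (n + 1)) k} {e : ℕ} (hG : G.IsHomogeneous e) :
    (dehom G).totalDegree ≤ e := by
  rw [← dehomHom_apply, ← support_sum_monomial_coeff G, map_sum]
  refine totalDegree_finsetSum_le fun α hα => ?_
  have degree_α : α.degree = e := (hG.degree_eq_sum_deg_support hα).symm
  rw [dehomHom_monomial]
  refine (totalDegree_monomial_le _ _).trans ?_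
  change α.tail.degree ≤ e
  rw [← degree_α, ← Finsupp.cons_tail α, degree_cons, Finsupp.tail_cons]
  exact Nat.le_add_left _ _

theorem degree_le_totalDegree {g : MvPolynomial (Fin n) k} {β : Fin n →₀ ℕ} (hβ : β ∈ g.support) :
    β.degree ≤ g.totalDegree :=
  le_totalDegree hβ

theorem homog_isHomogeneous (g : MvPolynomial (Fin n) k) :
    (homog g).IsHomogeneous g.totalDegree := by
  refine IsHomogeneous.sum _ _ _ fun β hβ => isHomogeneous_monomial _ ?_
  rw [degree_cons, Nat.sub_add_cancel (degree_le_totalDegree hβ)]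

theorem dehom_homog (g : MvPolynomial (Fin n) k) : dehom (homog g) = g := by
  rw [homog, ← dehomHom_apply, map_sum]
  simp only [dehomHom_monomial, Finsupp.tail_cons]
  exact support_sum_monomial_coeff g

theorem X_zero_pow_mul_homog_isHomogeneous {g : MvPolynomial (Fin n) k} {e : ℕ}
    (hg : g.totalDegree ≤ e) : (X 0 ^ (e - g.totalDegree) * homog g).IsHomogeneous e := by
  have := (isHomogeneous_X_pow (R := k) (0 : Fin (n + 1)) (e - g.totalDegree)).mul
    (homog_isHomogeneous g)
  rwa [Nat.sub_add_cancel hg] at this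

theorem dehom_X_zero_pow_mul_homog (a : ℕ) (g : MvPolynomial (Fin n) k) :
    dehom (X 0 ^ a * homog g) = g := by
  rw [dehom_X_zero_pow_mul, dehom_homog]

theorem eq_X_zero_pow_mul_homog_dehom {G : MvPolynomial (Fin (n + 1)) k} {e : ℕ}
    (hG : G.IsHomogeneous e) : G = X 0 ^ (e - (dehom G).totalDegree) * homog (dehom G) :=
  dehom_injOn hG (X_zero_pow_mul_homog_isHomogeneous (totalDegree_dehom_le hG))
    (dehom_X_zero_pow_mul_homog _ _).symm

end Dehomogenization

section HomogenizationOfIdeals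

variable {k : Type*} [Field k] {n : ℕ}

theorem dehomHom_surjective :
    Function.Surjective (dehomHom : MvPolynomial (Fin (n + 1)) k →ₐ[k] MvPolynomial (Fin n) k) :=
  fun g => ⟨homog g, dehom_homog g⟩

theorem homogIdeal_isHomogeneous (J : Ideal (MvPolynomial (Fin n) k)) :
    (homogIdeal J).IsHomogeneous (homogeneousSubmodule (Fin (n + 1)) k) := by
  refine Ideal.homogeneous_span _ _ ?_
  rintro _ ⟨g, -, rfl⟩
  exact ⟨_, homog_isHomogeneous g⟩

theorem dehom_mem_of_mem_homogIdeal {J : Ideal (MvPolynomial (Fin n) k)}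
    {G : MvPolynomial (Fin (n + 1)) k} (hG : G ∈ homogIdeal J) : dehom G ∈ J := by
  suffices homogIdeal J ≤ J.comap dehomHom from this hG
  refine Ideal.span_le.2 ?_
  rintro _ ⟨g, hg, rfl⟩
  change dehom (homog g) ∈ J
  rwa [dehom_homog]

theorem mem_homogIdeal_iff {J : Ideal (MvPolynomial (Fin n) k)}
    {G : MvPolynomial (Fin (n + 1)) k} {e : ℕ} (hG : G.IsHomogeneous e) :
    G ∈ homogIdeal J ↔ dehom G ∈ J := by
  refine ⟨dehom_mem_of_mem_homogIdeal, fun h => ?_⟩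
  rw [eq_X_zero_pow_mul_homog_dehom hG]
  exact Ideal.mul_mem_left _ _ (Ideal.subset_span ⟨_, h, rfl⟩)

theorem homogIdeal_mono {J K : Ideal (MvPolynomial (Fin n) k)} (h : J ≤ K) :
    homogIdeal J ≤ homogIdeal K :=
  Ideal.span_mono (Set.image_mono h)

theorem mem_homogIdeal_of_X_zero_mul_mem {J : Ideal (MvPolynomial (Fin n) k)}
    {G : MvPolynomial (Fin (n + 1)) k} (hG : X 0 * G ∈ homogIdeal J) : G ∈ homogIdeal J := by
  suffices (homogIdeal J).colon {X 0} ≤ homogIdeal J from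
    this (Submodule.mem_colon_singleton.2 (by rwa [smul_eq_mul, mul_comm]))
  refine le_of_forall_isHomogeneous
    (colon_singleton_isHomogeneous (homogIdeal_isHomogeneous J) (isHomogeneous_X k 0))
    fun e H hH hmem => ?_
  rw [Submodule.mem_colon_singleton, smul_eq_mul, mul_comm] at hmem
  rw [mem_homogIdeal_iff hH, ← dehom_X_zero_pow_mul 1, pow_one]
  exact dehom_mem_of_mem_homogIdeal hmem

theorem homogIdeal_mul_le (J K : Ideal (MvPolynomial (Fin n) k)) :
    homogIdeal J * homogIdeal K ≤ homogIdeal (J * K) := by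
  rw [homogIdeal, homogIdeal, Ideal.span_mul_span', Ideal.span_le]
  rintro _ ⟨_, ⟨g, hg, rfl⟩, _, ⟨h, hh, rfl⟩, rfl⟩
  refine (mem_homogIdeal_iff ((homog_isHomogeneous g).mul (homog_isHomogeneous h))).2 ?_
  rw [← dehomHom_apply, map_mul, dehomHom_apply, dehomHom_apply, dehom_homog, dehom_homog]
  exact Ideal.mul_mem_mul hg hh

theorem homogIdeal_pow_le (J : Ideal (MvPolynomial (Fin n) k)) (r : ℕ) :
    homogIdeal J ^ r ≤ homogIdeal (J ^ r) := by
  induction r with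
  | zero =>
    rw [pow_zero, Ideal.one_eq_top, top_le_iff, Ideal.eq_top_iff_one,
      mem_homogIdeal_iff (isHomogeneous_one _ _), pow_zero, Ideal.one_eq_top]
    exact Submodule.mem_top
  | succ r ih => exact (Ideal.mul_mono_left ih).trans (homogIdeal_mul_le (J ^ r) J)

theorem le_map_dehomHom_homogIdeal (J : Ideal (MvPolynomial (Fin n) k)) :
    J ≤ (homogIdeal J).map dehomHom := by
  intro g hg
  rw [← dehom_homog g]
  exact Ideal.mem_map_of_mem dehomHom (Ideal.subset_span ⟨g, hg, rfl⟩)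

theorem exists_isHomogeneous_mem_dehom_eq {Q : Ideal (MvPolynomial (Fin (n + 1)) k)}
    (hQ : Q.IsHomogeneous (homogeneousSubmodule (Fin (n + 1)) k))
    {H : MvPolynomial (Fin (n + 1)) k} (hH : H ∈ Q) {N : ℕ} (hN : H.totalDegree ≤ N) :
    ∃ G ∈ Q, G.IsHomogeneous N ∧ dehom G = dehom H := by
  refine ⟨∑ i ∈ Finset.range (H.totalDegree + 1), X 0 ^ (N - i) * homogeneousComponent i H,
    Q.sum_mem fun i _ => Q.mul_mem_left _ (homogeneousComponent_mem_of_mem hQ hH i),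
    IsHomogeneous.sum _ _ _ fun i hi => ?_, ?_⟩
  · have := (isHomogeneous_X_pow (R := k) (0 : Fin (n + 1)) (N - i)).mul
      (homogeneousComponent_isHomogeneous i H)
    rwa [Nat.sub_add_cancel (by grind)] at this
  · conv_rhs => rw [← sum_homogeneousComponent H, ← dehomHom_apply, map_sum]
    rw [← dehomHom_apply, map_sum]
    exact Finset.sum_congr rfl fun i _ => dehom_X_zero_pow_mul _ _

theorem mem_of_dehom_mem_map {Q : Ideal (MvPolynomial (Fin (n + 1)) k)}
    (hQ : Q.IsHomogeneous (homogeneousSubmodule (Fin (n + 1)) k))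
    (hsat : ∀ G, X 0 * G ∈ Q → G ∈ Q) {G : MvPolynomial (Fin (n + 1)) k} {e : ℕ}
    (hG : G.IsHomogeneous e) (h : dehom G ∈ Q.map dehomHom) : G ∈ Q := by
  have mem_of_X_zero_pow_mul_mem (a : ℕ) : X 0 ^ a * G ∈ Q → G ∈ Q := by
    induction a with
    | zero => simp
    | succ a ih => exact fun h => ih (hsat _ (by rwa [← mul_assoc, ← pow_succ']))
  obtain ⟨H, hH, H_eq⟩ := (Ideal.mem_map_iff_of_surjective _ dehomHom_surjective).1 h
  obtain ⟨H', hH', H'_hom, H'_eq⟩ :=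
    exists_isHomogeneous_mem_dehom_eq hQ hH (Nat.le_add_left H.totalDegree e)
  have G_hom : (X 0 ^ H.totalDegree * G).IsHomogeneous (e + H.totalDegree) :=
    add_comm e _ ▸ (isHomogeneous_X_pow 0 H.totalDegree).mul hG
  refine mem_of_X_zero_pow_mul_mem H.totalDegree ?_
  rwa [dehom_injOn G_hom H'_hom (by rw [dehom_X_zero_pow_mul, H'_eq, ← H_eq]; rfl)]

/-! ### Homogenized annihilators -/

theorem mem_idealOfVars_iff {m : ℕ} {g : MvPolynomial (Fin m) k} :
    g ∈ idealOfVars (Fin m) k ↔ coeff 0 g = 0 := by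
  simpa [Finsupp.degree_eq_zero_iff] using mem_pow_idealOfVars_iff' 1 g

theorem exists_totalDegree_le_sub_mem {m : ℕ} (g : MvPolynomial (Fin m) k) (d : ℕ) :
    ∃ g₁ : MvPolynomial (Fin m) k,
      g₁.totalDegree ≤ d ∧ g - g₁ ∈ idealOfVars (Fin m) k ^ (d + 1) := by
  classical
  refine ⟨∑ i ∈ Finset.range (d + 1), homogeneousComponent i g,
    totalDegree_finsetSum_le fun i hi =>
      (homogeneousComponent_isHomogeneous i g).totalDegree_le.trans
        (Finset.mem_range_succ_iff.1 hi), ?_⟩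
  rw [mem_pow_idealOfVars_iff']
  intro β hβ
  simp only [coeff_sub, coeff_sum, coeff_homogeneousComponent]
  rw [Finset.sum_ite_eq, if_pos (Finset.mem_range.2 hβ), sub_self]

theorem contractPairing_dehom {G F : MvPolynomial (Fin (n + 1)) k} {d : ℕ}
    (hG : G.IsHomogeneous d) (hF : F.IsHomogeneous d) :
    contractPairing (dehom G) (dehom F) = contractPairing G F := by
  rw [contractPairing_eq_sum G F, ← dehomHom_apply]
  conv_lhs => rw [← support_sum_monomial_coeff G, map_sum, map_sum, LinearMap.sum_apply]
  refine Finset.sum_congr rfl fun α hα => ?_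
  have degree_α : α.degree = d := (hG.degree_eq_sum_deg_support hα).symm
  rw [dehomHom_monomial, contractPairing_monomial, coeff_tail_dehom hF degree_α]

theorem homogIdeal_contractAnn_dehom_le {F : MvPolynomial (Fin (n + 1)) k} {d : ℕ}
    (hF : F.IsHomogeneous d) : homogIdeal (contractAnn (dehom F)) ≤ contractAnn F := by
  refine le_contractAnn_of_isHomogeneous (homogIdeal_isHomogeneous _) hF fun G hG G_hom => ?_
  rw [← contractPairing_dehom G_hom hF]
  exact contractPairing_eq_zero (dehom_mem_of_mem_homogIdeal hG)

theorem homogIdeal_idealOfVars_pow_le {F : MvPolynomial (Fin (n + 1)) k} {d : ℕ}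
    (hF : F.IsHomogeneous d) :
    homogIdeal (idealOfVars (Fin n) k) ^ (d + 1) ≤ homogIdeal (contractAnn (dehom F)) :=
  (homogIdeal_pow_le _ _).trans
    (homogIdeal_mono (idealOfVars_pow_le_contractAnn (totalDegree_dehom_le hF)))

theorem le_homogIdeal_contractAnn_dehom {F : MvPolynomial (Fin (n + 1)) k} {d : ℕ}
    (hF : F.IsHomogeneous d) {Q : Ideal (MvPolynomial (Fin (n + 1)) k)}
    (hQ : Q.IsHomogeneous (homogeneousSubmodule (Fin (n + 1)) k))
    (hsat : ∀ G, X 0 * G ∈ Q → G ∈ Q)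
    (hfat : homogIdeal (idealOfVars (Fin n) k) ^ (d + 1) ≤ Q) (hQF : Q ≤ contractAnn F) :
    Q ≤ homogIdeal (contractAnn (dehom F)) := by
  have pow_le_map : idealOfVars (Fin n) k ^ (d + 1) ≤ Q.map dehomHom :=
    (Ideal.pow_right_mono (le_map_dehomHom_homogIdeal _) _).trans
      ((Ideal.map_pow dehomHom _ _).symm.le.trans (Ideal.map_mono hfat))
  have map_le : Q.map dehomHom ≤ contractAnn (dehom F) := by
    refine le_contractAnn fun g hg => ?_
    -- Modulo `𝔪 ^ (d + 1)`, which annihilates `dehom F`, `g` lifts to a form of degree `d` in `Q`.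
    obtain ⟨g₁, totalDegree_g₁, sub_mem⟩ := exists_totalDegree_le_sub_mem g d
    have g₁_mem : g₁ ∈ Q.map dehomHom := by
      simpa using (Q.map dehomHom).sub_mem hg (pow_le_map sub_mem)
    have G₁_hom := X_zero_pow_mul_homog_isHomogeneous totalDegree_g₁
    have dehom_G₁ := dehom_X_zero_pow_mul_homog (d - g₁.totalDegree) g₁
    set G₁ := X 0 ^ (d - g₁.totalDegree) * homog g₁
    have G₁_mem : G₁ ∈ Q := mem_of_dehom_mem_map hQ hsat G₁_hom (by rwa [dehom_G₁])
    calc contractPairing g (dehom F)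
        = contractPairing (g - g₁) (dehom F) + contractPairing (dehom G₁) (dehom F) := by
          rw [dehom_G₁, ← LinearMap.add_apply, ← map_add, sub_add_cancel]
      _ = 0 + contractPairing G₁ F := by
          rw [contractPairing_dehom G₁_hom hF, contractPairing_eq_zero
            (idealOfVars_pow_le_contractAnn (totalDegree_dehom_le hF) sub_mem)]
      _ = 0 := by rw [contractPairing_eq_zero (hQF G₁_mem), add_zero]
  exact le_of_forall_isHomogeneous hQ fun e G G_hom hG =>
    (mem_homogIdeal_iff G_hom).2 (map_le (Ideal.mem_map_of_mem dehomHom hG))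

end HomogenizationOfIdeals

/-! ### Ideals of points -/

section Points

variable {k : Type*} [Field k] {n : ℕ} {L : MvPolynomial (Fin (n + 1)) k}

theorem eval_eq_zero_of_mem_pointIdeal {G : MvPolynomial (Fin (n + 1)) k}
    (hG : G ∈ pointIdeal L) : eval (coeffVec L) G = 0 := by
  suffices pointIdeal L ≤ RingHom.ker (eval (coeffVec L)) from this hG
  exact Ideal.span_le.2 fun H hH => hH.2

theorem mem_pointIdeal_iff {G : MvPolynomial (Fin (n + 1)) k} {e : ℕ} (hG : G.IsHomogeneous e) :
    G ∈ pointIdeal L ↔ eval (coeffVec L) G = 0 :=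
  ⟨eval_eq_zero_of_mem_pointIdeal, fun h => Ideal.subset_span ⟨⟨e, hG⟩, h⟩⟩

theorem pointIdeal_isHomogeneous (L : MvPolynomial (Fin (n + 1)) k) :
    (pointIdeal L).IsHomogeneous (homogeneousSubmodule (Fin (n + 1)) k) :=
  Ideal.homogeneous_span _ _ fun _ hG => hG.1

theorem eval_mul_sub_eval_mul_mem_pointIdeal {G H : MvPolynomial (Fin (n + 1)) k} {e : ℕ}
    (hG : G.IsHomogeneous e) (hH : H.IsHomogeneous e) :
    C (eval (coeffVec L) H) * G - C (eval (coeffVec L) G) * H ∈ pointIdeal L := by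
  rw [mem_pointIdeal_iff ((hG.C_mul _).sub (hH.C_mul _)), map_sub, map_mul, map_mul, eval_C, eval_C,
    mul_comm, sub_self]

theorem X_mem_of_pointIdeal_le {P : Ideal (MvPolynomial (Fin (n + 1)) k)} [hPp : P.IsPrime]
    (hP : pointIdeal L ≤ P) {G : MvPolynomial (Fin (n + 1)) k} {e : ℕ} (G_hom : G.IsHomogeneous e)
    (hG : G ∈ P) (hGL : G ∉ pointIdeal L) (i : Fin (n + 1)) : X i ∈ P := by
  rw [mem_pointIdeal_iff G_hom] at hGL
  have eval_mul_mem : C (eval (coeffVec L) G) * X i ^ e ∈ P := by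
    have := hP (eval_mul_sub_eval_mul_mem_pointIdeal (L := L) G_hom (isHomogeneous_X_pow i e))
    exact (P.sub_mem_iff_right (P.mul_mem_left _ hG)).1 this
  exact hPp.mem_of_pow_mem e
    ((Ideal.unit_mul_mem_iff_mem P ((isUnit_iff_ne_zero.2 hGL).map C)).1 eval_mul_mem)

theorem eq_pointIdeal_of_le {P : Ideal (MvPolynomial (Fin (n + 1)) k)} [P.IsPrime]
    (P_hom : P.IsHomogeneous (homogeneousSubmodule (Fin (n + 1)) k)) (hP : pointIdeal L ≤ P)
    {i : Fin (n + 1)} (hi : X i ∉ P) : P = pointIdeal L :=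
  le_antisymm
    (le_of_forall_isHomogeneous P_hom fun _ _ G_hom hG =>
      by_contra fun hGL => hi (X_mem_of_pointIdeal_le hP G_hom hG hGL i))
    hP

theorem eval_smul_of_isHomogeneous {σ R : Type*} [CommSemiring R] {e : ℕ} {G : MvPolynomial σ R}
    (hG : G.IsHomogeneous e) (c : R) (a : σ → R) : eval (c • a) G = c ^ e * eval a G := by
  rw [eval_eq, eval_eq, Finset.mul_sum]
  refine Finset.sum_congr rfl fun α hα => ?_
  rw [hG.degree_eq_sum_deg_support hα, ← Finset.prod_pow_eq_pow_sum]
  simp only [Pi.smul_apply, smul_eq_mul, mul_pow, Finset.prod_mul_distrib]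
  ring

theorem pointIdeal_smul (L : MvPolynomial (Fin (n + 1)) k) {c : k} (hc : c ≠ 0) :
    pointIdeal (c • L) = pointIdeal L := by
  have coeffVec_smul : coeffVec (c • L) = c • coeffVec L := by
    funext i
    simp [coeffVec]
  rw [pointIdeal, pointIdeal, coeffVec_smul]
  congr 1
  ext G
  refine and_congr_right fun ⟨e, hG⟩ => ?_
  rw [eval_smul_of_isHomogeneous hG, mul_eq_zero_iff_left (pow_ne_zero e hc)]

end Points

/-! ### Natural apolar ideals -/

section NaturalApolarIdeals

variable {k : Type*} [Field k] {n : ℕ} (A : Matrix.GeneralLinearGroup (Fin (n + 1)) k)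

theorem eval_single_linSubst_transpose (G : MvPolynomial (Fin (n + 1)) k) :
    eval (Pi.single 0 1) (linSubst A.1.transpose G) = eval (A.1 0) G := by
  rw [eval_linSubst, Matrix.mulVec_single_one]
  rfl

theorem map_dualCoords_isHomogeneous {I : Ideal (MvPolynomial (Fin (n + 1)) k)}
    (hI : I.IsHomogeneous (homogeneousSubmodule (Fin (n + 1)) k)) :
    (I.map (dualCoords A)).IsHomogeneous (homogeneousSubmodule (Fin (n + 1)) k) :=
  map_dualCoords A I ▸ comap_linSubst_isHomogeneous _ hI

theorem pointIdeal_eq_map_dualCoords :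
    pointIdeal (linForm (A.1 0)) = (homogIdeal (idealOfVars (Fin n) k)).map (dualCoords A) := by
  have mem_iff (e : ℕ) (G : MvPolynomial (Fin (n + 1)) k) (hG : G.IsHomogeneous e) :
      G ∈ pointIdeal (linForm (A.1 0)) ↔
        G ∈ (homogIdeal (idealOfVars (Fin n) k)).map (dualCoords A) := by
    rw [map_dualCoords, Ideal.mem_comap, mem_homogIdeal_iff (linSubst_isHomogeneous _ hG),
      mem_idealOfVars_iff, coeff_zero_dehom, eval_single_linSubst_transpose, mem_pointIdeal_iff hG,
      coeffVec_linForm]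
  exact le_antisymm
    (le_of_forall_isHomogeneous (pointIdeal_isHomogeneous _) fun e G G_hom => (mem_iff e G G_hom).1)
    (le_of_forall_isHomogeneous (map_dualCoords_isHomogeneous A (homogIdeal_isHomogeneous _))
      fun e G G_hom => (mem_iff e G G_hom).2)

theorem dualCoords_X_isHomogeneous (i : Fin (n + 1)) : (dualCoords A (X i)).IsHomogeneous 1 :=
  linSubst_isHomogeneous _ (isHomogeneous_X k i)

theorem dualCoords_X_zero_notMem_pointIdeal :
    dualCoords A (X 0) ∉ pointIdeal (linForm (A.1 0)) := by
  rw [mem_pointIdeal_iff (dualCoords_X_isHomogeneous A 0), coeffVec_linForm,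
    ← eval_single_linSubst_transpose, linSubst_dualCoords, eval_X, Pi.single_eq_same]
  exact one_ne_zero

theorem comap_dualCoords_contractAnn [CharZero k] (F : MvPolynomial (Fin (n + 1)) k) :
    (contractAnn (toDP F)).comap (dualCoords A) = contractAnn (toDP (changeCoords A F)) := by
  ext G
  rw [Ideal.mem_comap, ← diffAct_eq_zero_iff, diffAct_dualCoords_eq_zero_iff, diffAct_eq_zero_iff]

variable {F L : MvPolynomial (Fin (n + 1)) k} {d : ℕ}

theorem exists_naturalApolarIdeal_eq (F : MvPolynomial (Fin (n + 1)) k)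
    (hL : L.IsHomogeneous 1) (hL0 : L ≠ 0) :
    ∃ A : Matrix.GeneralLinearGroup (Fin (n + 1)) k,
      linForm (A.1 0) = L ∧ naturalApolarIdeal F L = naturalApolarIdealIn A F := by
  have h := exists_coords L hL hL0
  refine ⟨h.choose, h.choose_spec, ?_⟩
  rw [naturalApolarIdeal, dif_pos h]

theorem naturalApolarIdeal_isHomogeneous (F : MvPolynomial (Fin (n + 1)) k)
    (hL : L.IsHomogeneous 1) (hL0 : L ≠ 0) :
    (naturalApolarIdeal F L).IsHomogeneous (homogeneousSubmodule (Fin (n + 1)) k) := by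
  obtain ⟨A, -, natural_eq⟩ := exists_naturalApolarIdeal_eq F hL hL0
  rw [natural_eq]
  exact map_dualCoords_isHomogeneous A (homogIdeal_isHomogeneous _)

theorem naturalApolarIdeal_saturated (hL : L.IsHomogeneous 1) (hL0 : L ≠ 0)
    {G : MvPolynomial (Fin (n + 1)) k} (hG : ∀ i, X i * G ∈ naturalApolarIdeal F L) :
    G ∈ naturalApolarIdeal F L := by
  obtain ⟨A, -, natural_eq⟩ := exists_naturalApolarIdeal_eq F hL hL0
  have mul_mem : dualCoords A (X 0) * G ∈ naturalApolarIdeal F L := by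
    rw [dualCoords, aeval_X, linForm, Finset.sum_mul]
    refine Ideal.sum_mem _ fun i _ => ?_
    rw [mul_assoc]
    exact Ideal.mul_mem_left _ _ (hG i)
  rw [natural_eq, naturalApolarIdealIn, map_dualCoords, Ideal.mem_comap] at mul_mem ⊢
  rw [map_mul, linSubst_dualCoords] at mul_mem
  exact mem_homogIdeal_of_X_zero_mul_mem mul_mem

theorem pointIdeal_pow_le_naturalApolarIdeal (hF : F.IsHomogeneous d) (hL : L.IsHomogeneous 1)
    (hL0 : L ≠ 0) : pointIdeal L ^ (d + 1) ≤ naturalApolarIdeal F L := by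
  obtain ⟨A, rfl, natural_eq⟩ := exists_naturalApolarIdeal_eq F hL hL0
  rw [natural_eq, pointIdeal_eq_map_dualCoords, ← Ideal.map_pow]
  exact Ideal.map_mono
    (homogIdeal_idealOfVars_pow_le (toDP_isHomogeneous (changeCoords_isHomogeneous A hF)))

theorem naturalApolarIdeal_le_contractAnn [CharZero k] (hF : F.IsHomogeneous d)
    (hL : L.IsHomogeneous 1) (hL0 : L ≠ 0) : naturalApolarIdeal F L ≤ contractAnn (toDP F) := by
  obtain ⟨A, -, natural_eq⟩ := exists_naturalApolarIdeal_eq F hL hL0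
  rw [natural_eq, naturalApolarIdealIn, Ideal.map_le_iff_le_comap, comap_dualCoords_contractAnn]
  exact homogIdeal_contractAnn_dehom_le (toDP_isHomogeneous (changeCoords_isHomogeneous A hF))

theorem le_naturalApolarIdeal [CharZero k] (hF : F.IsHomogeneous d) (hL : L.IsHomogeneous 1)
    (hL0 : L ≠ 0) {Q : Ideal (MvPolynomial (Fin (n + 1)) k)}
    (hQ : Q.IsHomogeneous (homogeneousSubmodule (Fin (n + 1)) k))
    (hsat : ∀ M G, M.IsHomogeneous 1 → M ∉ pointIdeal L → M * G ∈ Q → G ∈ Q)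
    (hfat : pointIdeal L ^ (d + 1) ≤ Q) (hQF : Q ≤ contractAnn (toDP F)) :
    Q ≤ naturalApolarIdeal F L := by
  obtain ⟨A, rfl, natural_eq⟩ := exists_naturalApolarIdeal_eq F hL hL0
  rw [pointIdeal_eq_map_dualCoords, ← Ideal.map_pow, Ideal.map_le_iff_le_comap] at hfat
  have dualCoords_surjective : Function.Surjective (dualCoords A) :=
    fun G => ⟨_, dualCoords_linSubst A G⟩
  have comap_le : Q.comap (dualCoords A) ≤
      homogIdeal (contractAnn (dehom (toDP (changeCoords A F)))) := by
    refine le_homogIdeal_contractAnn_dehom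
      (toDP_isHomogeneous (changeCoords_isHomogeneous A hF)) ?_ (fun G hG => ?_) hfat ?_
    · exact comap_linSubst_isHomogeneous _ hQ
    · rw [Ideal.mem_comap, map_mul] at hG
      exact hsat _ _ (dualCoords_X_isHomogeneous A 0) (dualCoords_X_zero_notMem_pointIdeal A) hG
    · rw [← comap_dualCoords_contractAnn]
      exact Ideal.comap_mono hQF
  rw [natural_eq, ← Ideal.map_comap_of_surjective _ dualCoords_surjective Q]
  exact Ideal.map_mono comap_le

end NaturalApolarIdeals

/-! ### Components -/

section Saturation

variable {k : Type*} [Field k] {m : ℕ} {I : Ideal (MvPolynomial (Fin m) k)}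

theorem mem_of_X_mem_radical_colon (I_sat : ∀ G, (∀ i, X i * G ∈ I) → G ∈ I)
    {G : MvPolynomial (Fin m) k} (hG : ∀ i, X i ∈ (I.colon {G}).radical) : G ∈ I := by
  obtain ⟨N, hN⟩ := Ideal.exists_pow_le_of_le_radical_of_fg
    (Ideal.span_le.2 (Set.range_subset_iff.2 hG)) (idealOfVars_fg (Fin m) k)
  clear hG
  induction N generalizing G with
  | zero =>
    rw [pow_zero, Ideal.one_eq_top, top_le_iff, Ideal.eq_top_iff_one] at hN
    simpa using Submodule.mem_colon_singleton.1 hN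
  | succ N ih =>
    refine I_sat G fun i => ih fun H hH => ?_
    have mul_X_mem := hN (Ideal.mul_mem_mul hH (Ideal.subset_span ⟨i, rfl⟩))
    rw [Submodule.mem_colon_singleton, smul_eq_mul] at mul_X_mem ⊢
    rwa [← mul_assoc]

theorem le_idealOfVars_of_isHomogeneous (I_hom : I.IsHomogeneous (homogeneousSubmodule (Fin m) k))
    (I_ne_top : I ≠ ⊤) : I ≤ idealOfVars (Fin m) k := by
  intro G hG
  have C_mem := homogeneousComponent_mem_of_mem I_hom hG 0
  rw [homogeneousComponent_zero] at C_mem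
  rw [mem_idealOfVars_iff]
  by_contra coeff_ne_zero
  exact I_ne_top (I.eq_top_of_isUnit_mem C_mem ((isUnit_iff_ne_zero.2 coeff_ne_zero).map C))

theorem exists_X_notMem_of_mem_minimalPrimes
    (I_hom : I.IsHomogeneous (homogeneousSubmodule (Fin m) k))
    (I_sat : ∀ G, (∀ i, X i * G ∈ I) → G ∈ I) {P : Ideal (MvPolynomial (Fin m) k)}
    (hP : P ∈ I.minimalPrimes) : ∃ i, X i ∉ P := by
  by_contra! X_mem
  have vars_le : idealOfVars (Fin m) k ≤ P := Ideal.span_le.2 (Set.range_subset_iff.2 X_mem)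
  have P_le (Q) (hQ : Q ∈ I.minimalPrimes) : P ≤ Q :=
    hP.2 hQ.1 ((le_idealOfVars_of_isHomogeneous (isHomogeneous_of_mem_minimalPrimes I_hom hQ)
      hQ.1.1.ne_top).trans vars_le)
  have one_mem : (1 : MvPolynomial (Fin m) k) ∈ I := by
    refine mem_of_X_mem_radical_colon I_sat fun i => Ideal.radical_mono Ideal.le_colon ?_
    rw [← Ideal.sInf_minimalPrimes]
    exact Ideal.mem_sInf.2 fun {Q} hQ => P_le Q hQ (X_mem i)
  exact hP.1.1.ne_top ((Ideal.eq_top_iff_one P).2 (hP.1.2 one_mem))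

end Saturation

theorem exists_notMem_mul_mem_of_iInf_le {R ι : Type*} [CommRing R] [Finite ι] {I P : Ideal R}
    [P.IsPrime] {J : ι → Ideal R} (hJ : ⨅ i, J i ≤ I) {x : R} (hx : ∀ i, J i ≤ P → x ∈ J i) :
    ∃ y ∉ P, y * x ∈ I := by
  have := Fintype.ofFinite ι
  have exists_notMem (i) : ∃ y ∉ P, y * x ∈ J i := by
    by_cases hi : J i ≤ P
    · exact ⟨1, P.one_notMem, (J i).mul_mem_left 1 (hx i hi)⟩
    · obtain ⟨y, hy, hyP⟩ := SetLike.not_le_iff_exists.1 hi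
      exact ⟨y, hyP, (J i).mul_mem_right x hy⟩
  choose y hyP hy using exists_notMem
  refine ⟨∏ i, y i, fun h => ?_, hJ (Ideal.mem_iInf.2 fun i => ?_)⟩
  · obtain ⟨i, -, hi⟩ := Ideal.IsPrime.prod_mem_iff.1 h
    exact hyP i hi
  · exact (J i).mem_of_dvd (mul_dvd_mul_right (Finset.dvd_prod_of_mem y (Finset.mem_univ i)) x)
      (hy i)

instance isPrime_of_minimalPrimes {R : Type*} [CommSemiring R] {I : Ideal R}
    (P : I.minimalPrimes) : P.1.IsPrime :=
  P.2.1.1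

section Components

variable {k : Type*} [Field k] {n : ℕ} (Z : ZeroDimScheme k n)
  {P : Ideal (MvPolynomial (Fin (n + 1)) k)} [hPp : P.IsPrime]

theorem mem_componentIdeal_iff {G : MvPolynomial (Fin (n + 1)) k} :
    G ∈ componentIdeal Z P ↔ ∃ H ∉ P, H * G ∈ Z.ideal := by
  rw [componentIdeal, Ideal.mem_comap,
    IsLocalization.algebraMap_mem_map_algebraMap_iff P.primeCompl]
  rfl

theorem componentIdeal_le (hP : Z.ideal ≤ P) : componentIdeal Z P ≤ P := by
  intro G hG
  obtain ⟨H, hHP, hHG⟩ := (mem_componentIdeal_iff Z).1 hG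
  exact (hPp.mem_or_mem (hP hHG)).resolve_left hHP

variable (P) in
/-- The largest homogeneous ideal inside the component of `Z` at `P`. Taking the homogeneous core
spares a proof that the component is itself homogeneous. -/
def homogeneousComponentIdeal : Ideal (MvPolynomial (Fin (n + 1)) k) :=
  ((componentIdeal Z P).homogeneousCore (homogeneousSubmodule (Fin (n + 1)) k)).toIdeal

variable (P) in
theorem homogeneousComponentIdeal_isHomogeneous :
    (homogeneousComponentIdeal Z P).IsHomogeneous (homogeneousSubmodule (Fin (n + 1)) k) :=
  HomogeneousIdeal.isHomogeneous _

theorem le_homogeneousComponentIdeal {K : Ideal (MvPolynomial (Fin (n + 1)) k)}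
    (hK : K.IsHomogeneous (homogeneousSubmodule (Fin (n + 1)) k)) (h : K ≤ componentIdeal Z P) :
    K ≤ homogeneousComponentIdeal Z P :=
  hK.toIdeal_homogeneousCore_eq_self.symm.le.trans (Ideal.homogeneousCore_mono _ h)

theorem mem_homogeneousComponentIdeal_iff {G : MvPolynomial (Fin (n + 1)) k} {e : ℕ}
    (hG : G.IsHomogeneous e) :
    G ∈ homogeneousComponentIdeal Z P ↔ ∃ H ∉ P, H * G ∈ Z.ideal := by
  rw [← mem_componentIdeal_iff]
  exact ⟨fun h => Ideal.toIdeal_homogeneousCore_le _ _ h,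
    Ideal.mem_homogeneousCore_of_homogeneous_of_mem ⟨e, hG⟩⟩

theorem ideal_le_homogeneousComponentIdeal : Z.ideal ≤ homogeneousComponentIdeal Z P :=
  le_homogeneousComponentIdeal Z Z.homogeneous Ideal.le_comap_map

theorem mem_homogeneousComponentIdeal_of_mul_mem {H G : MvPolynomial (Fin (n + 1)) k} {e : ℕ}
    (hH : H.IsHomogeneous e) (hHP : H ∉ P) (hHG : H * G ∈ homogeneousComponentIdeal Z P) :
    G ∈ homogeneousComponentIdeal Z P := by
  have colon_hom :=
    colon_singleton_isHomogeneous (homogeneousComponentIdeal_isHomogeneous Z P) hH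
  have hG : G ∈ (homogeneousComponentIdeal Z P).colon {H} :=
    Submodule.mem_colon_singleton.2 (by rwa [smul_eq_mul, mul_comm])
  refine le_of_forall_isHomogeneous colon_hom (fun e' G' hG' hG'H => ?_) hG
  rw [Submodule.mem_colon_singleton, smul_eq_mul,
    mem_homogeneousComponentIdeal_iff Z (IsHomogeneous.mul hG' hH)] at hG'H
  obtain ⟨K, hKP, hK⟩ := hG'H
  refine (mem_homogeneousComponentIdeal_iff Z hG').2 ⟨K * H, hPp.mul_notMem hKP hHP, ?_⟩
  rwa [mul_assoc, mul_comm H]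

theorem iInf_homogeneousComponentIdeal_le
    (hpt : ∀ P ∈ Z.ideal.minimalPrimes, ∃ L, P = pointIdeal L) :
    ⨅ P : Z.ideal.minimalPrimes, homogeneousComponentIdeal Z P.1 ≤ Z.ideal := by
  have iInf_hom := Ideal.IsHomogeneous.iInf fun P : Z.ideal.minimalPrimes =>
    homogeneousComponentIdeal_isHomogeneous Z P.1
  refine le_of_forall_isHomogeneous iInf_hom fun e G hG hGZ => ?_
  refine mem_of_X_mem_radical_colon Z.saturated fun i => ?_
  rw [← Ideal.sInf_minimalPrimes]
  refine Ideal.mem_sInf.2 fun {Q} hQ => ?_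
  have hQp : Q.IsPrime := hQ.1.1
  obtain ⟨P, hP, hPQ⟩ := Ideal.exists_minimalPrimes_le (Ideal.le_colon.trans hQ.1.2)
  have hPp : P.IsPrime := hP.1.1
  have not_le : ¬ Z.ideal.colon {G} ≤ P := fun hle => by
    obtain ⟨H, hHP, hHG⟩ :=
      (mem_homogeneousComponentIdeal_iff Z hG).1 (Ideal.mem_iInf.1 hGZ ⟨P, hP⟩)
    exact hHP (hle (Submodule.mem_colon_singleton.2 hHG))
  obtain ⟨L, rfl⟩ := hpt P hP
  by_contra X_notMem
  exact not_le (le_of_forall_isHomogeneous (colon_singleton_isHomogeneous Z.homogeneous hG)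
    fun _ H hH hHG => by_contra fun hHL =>
      X_notMem (X_mem_of_pointIdeal_le hPQ hH (hQ.1.2 hHG) hHL i))

theorem exists_pointIdeal_pow_le_componentIdeal {r : ℕ} {ι : Type*} [Finite ι]
    {L : ι → MvPolynomial (Fin (n + 1)) k} (hL : ⨅ i, pointIdeal (L i) ^ r ≤ Z.ideal)
    (hP : P ∈ Z.ideal.minimalPrimes) : ∃ i, pointIdeal (L i) ^ r ≤ componentIdeal Z P := by
  have := Fintype.ofFinite ι
  have P_hom := isHomogeneous_of_mem_minimalPrimes Z.homogeneous hP
  obtain ⟨j, hj⟩ := exists_X_notMem_of_mem_minimalPrimes Z.homogeneous Z.saturated hP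
  obtain ⟨i₀, -, hi₀⟩ := hPp.inf_le'.1 ((Finset.inf_univ_eq_iInf _).le.trans (hL.trans hP.1.2))
  have P_eq (i) (hi : pointIdeal (L i) ^ r ≤ P) : P = pointIdeal (L i) :=
    eq_pointIdeal_of_le P_hom (hPp.le_of_pow_le hi) hj
  refine ⟨i₀, fun G hG => (mem_componentIdeal_iff Z).2
    (exists_notMem_mul_mem_of_iInf_le hL fun i hi => ?_)⟩
  rwa [← P_eq i hi, P_eq i₀ hi₀]

end Components

/-! ### Decomposition -/

section DualDecomposition

variable {k : Type*} [Field k] {m d : ℕ} {ι : Type*} [Fintype ι]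

theorem exists_contractPairing_eq (φ : Module.Dual k (MvPolynomial (Fin m) k)) (d : ℕ) :
    ∃ f : MvPolynomial (Fin m) k, f.IsHomogeneous d ∧
      ∀ g, g.IsHomogeneous d → contractPairing g f = φ g := by
  classical
  have finite_degree : {α : Fin m →₀ ℕ | α.degree = d}.Finite := Finsupp.finite_of_degree_eq d
  let f := ∑ α ∈ finite_degree.toFinset, monomial α (φ (monomial α 1))
  have coeff_f (α) (hα : α.degree = d) : coeff α f = φ (monomial α 1) := by
    simp only [f, coeff_sum, coeff_monomial]
    rw [Finset.sum_ite_eq', if_pos (finite_degree.mem_toFinset.2 hα)]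
  refine ⟨f, IsHomogeneous.sum _ _ _ fun α hα =>
    isHomogeneous_monomial _ (finite_degree.mem_toFinset.1 hα), fun g hg => ?_⟩
  rw [contractPairing_eq_sum]
  conv_rhs => rw [← support_sum_monomial_coeff g, map_sum]
  refine Finset.sum_congr rfl fun β hβ => ?_
  rw [coeff_f β (hg.degree_eq_sum_deg_support hβ).symm, ← smul_eq_mul, ← map_smul, smul_monomial,
    smul_eq_mul, mul_one]

theorem iInf_contractAnn_le (f : ι → MvPolynomial (Fin m) k) :
    ⨅ i, contractAnn (f i) ≤ contractAnn (∑ i, f i) := by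
  refine le_contractAnn fun g hg => ?_
  rw [map_sum]
  exact Finset.sum_eq_zero fun i _ => contractPairing_eq_zero (Ideal.mem_iInf.1 hg i)

/-- The functional `g ↦ (g f)(0)` vanishes on `⨅ i, Q i`, and the annihilator of a finite
intersection of subspaces is the sum of the annihilators. -/
theorem exists_sum_eq_of_iInf_le_contractAnn {Q : ι → Ideal (MvPolynomial (Fin m) k)}
    (hQ : ∀ i, (Q i).IsHomogeneous (homogeneousSubmodule (Fin m) k)) {f : MvPolynomial (Fin m) k}
    (hf : f.IsHomogeneous d) (hQf : ⨅ i, Q i ≤ contractAnn f) :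
    ∃ g : ι → MvPolynomial (Fin m) k, (∀ i, (g i).IsHomogeneous d) ∧ f = ∑ i, g i ∧
      ∀ i, Q i ≤ contractAnn (g i) := by
  have mem_dualAnnihilator :
      contractPairing.flip f ∈ (⨅ i, (Q i).restrictScalars k).dualAnnihilator :=
    (Submodule.mem_dualAnnihilator _).2 fun h hh =>
      contractPairing_eq_zero (hQf (by simpa [Submodule.mem_iInf] using hh))
  rw [Subspace.dualAnnihilator_iInf_eq, Submodule.mem_iSup_iff_exists_finsupp]
    at mem_dualAnnihilator
  obtain ⟨ψ, hψ, sum_ψ⟩ := mem_dualAnnihilator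
  rw [Finsupp.sum_fintype _ _ fun _ => rfl] at sum_ψ
  choose g g_hom g_pairing using fun i => exists_contractPairing_eq (ψ i) d
  refine ⟨g, g_hom, ?_, fun i => le_contractAnn_of_isHomogeneous (hQ i) (g_hom i) fun h hh h_hom =>
    (g_pairing i h h_hom).trans ((Submodule.mem_dualAnnihilator _).1 (hψ i) h hh)⟩
  ext α
  by_cases hα : α.degree = d
  · have pairing_eq : contractPairing (monomial α 1) f =
        ∑ i, contractPairing (monomial α 1) (g i) := by
      simp only [g_pairing _ _ (isHomogeneous_monomial _ hα)]
      rw [← LinearMap.sum_apply, sum_ψ, LinearMap.flip_apply]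
    simpa only [contractPairing_monomial, one_mul, coeff_sum] using pairing_eq
  · rw [hf.coeff_eq_zero hα, (IsHomogeneous.sum _ _ _ fun i _ => g_hom i).coeff_eq_zero hα]

theorem toDP_sum (F : ι → MvPolynomial (Fin m) k) : toDP (∑ i, F i) = ∑ i, toDP (F i) :=
  map_sum (AddMonoidHom.mk' toDP toDP_add) F _

theorem exists_sum_eq_of_iInf_le_contractAnn_toDP [CharZero k]
    {Q : ι → Ideal (MvPolynomial (Fin m) k)}
    (hQ : ∀ i, (Q i).IsHomogeneous (homogeneousSubmodule (Fin m) k)) {F : MvPolynomial (Fin m) k}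
    (hF : F.IsHomogeneous d) (hQF : ⨅ i, Q i ≤ contractAnn (toDP F)) :
    ∃ G : ι → MvPolynomial (Fin m) k, (∀ i, (G i).IsHomogeneous d) ∧ F = ∑ i, G i ∧
      ∀ i, Q i ≤ contractAnn (toDP (G i)) := by
  obtain ⟨g, g_hom, sum_g, hQg⟩ :=
    exists_sum_eq_of_iInf_le_contractAnn hQ (toDP_isHomogeneous hF) hQF
  choose G G_hom toDP_G using fun i => exists_toDP_eq (g_hom i)
  refine ⟨G, G_hom, toDP_injective ?_, fun i => (toDP_G i).symm ▸ hQg i⟩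
  simp only [toDP_sum, toDP_G, sum_g]

end DualDecomposition

section GADs

variable {k : Type*} [Field k] {n d : ℕ} {F : MvPolynomial (Fin (n + 1)) k}

theorem isHomogeneous_of_mul_left {σ R : Type*} [CommRing R] [IsDomain R] {r e : ℕ}
    {L G : MvPolynomial σ R}
    (hL : L.IsHomogeneous r) (hL0 : L ≠ 0) (hLG : (L * G).IsHomogeneous (r + e)) :
    G.IsHomogeneous e := by
  have mul_component : L * homogeneousComponent e G = L * G := by
    have decompose_eq (p i) : (DirectSum.decompose (homogeneousSubmodule σ R) p i :
        MvPolynomial σ R) = homogeneousComponent i p :=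
      decomposition.decompose'_apply p i
    rw [← decompose_eq, ← DirectSum.coe_decompose_mul_add_of_left_mem _ hL, decompose_eq,
      homogeneousComponent_eq_self hLG]
  rw [← mul_left_cancel₀ hL0 mul_component]
  exact homogeneousComponent_isHomogeneous e G

theorem not_isUnit_of_isHomogeneous {σ R : Type*} [CommSemiring R] [Nontrivial R] {e : ℕ}
    (he : e ≠ 0) {L : MvPolynomial σ R} (hL : L.IsHomogeneous e) : ¬ IsUnit L := by
  intro h
  have isUnit_coeff := h.map constantCoeff
  rw [constantCoeff_eq, hL.coeff_eq_zero (by simpa using he.symm)] at isUnit_coeff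
  exact not_isUnit_zero isUnit_coeff

theorem exists_eq_pow_mul_and_not_dvd {L : MvPolynomial (Fin (n + 1)) k} (hF : F.IsHomogeneous d)
    (hF0 : F ≠ 0) (hL : L.IsHomogeneous 1) (hL0 : L ≠ 0) :
    ∃ e G, e ≤ d ∧ G.IsHomogeneous e ∧ ¬ L ∣ G ∧ F = L ^ (d - e) * G := by
  obtain ⟨G, F_eq, hLG⟩ := (FiniteMultiplicity.of_not_isUnit
    (not_isUnit_of_isHomogeneous one_ne_zero hL) hF0).exists_eq_pow_mul_and_not_dvd
  set r := multiplicity L F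
  have hLr : (L ^ r).IsHomogeneous r := by simpa only [one_mul] using hL.pow r
  have hLr0 : L ^ r ≠ 0 := pow_ne_zero r hL0
  have hr : r ≤ d := by
    have := totalDegree_mul_of_isDomain hLr0 (right_ne_zero_of_mul (F_eq ▸ hF0))
    rw [← F_eq, hF.totalDegree hF0, hLr.totalDegree hLr0] at this
    omega
  refine ⟨d - r, G, Nat.sub_le d r, isHomogeneous_of_mul_left hLr hLr0 ?_, hLG, ?_⟩
  · rwa [← F_eq, Nat.add_sub_cancel' hr]
  · rwa [Nat.sub_sub_self hr]

theorem exists_GAD {ι : Type*} [Fintype ι] {G L : ι → MvPolynomial (Fin (n + 1)) k}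
    (hG : ∀ i, (G i).IsHomogeneous d) (hG0 : ∀ i, G i ≠ 0) (hL : ∀ i, (L i).IsHomogeneous 1)
    (hL0 : ∀ i, L i ≠ 0) (hprop : ∀ i j, i ≠ j → ∀ c : k, L i ≠ c • L j) (hF : F = ∑ i, G i) :
    ∃ D : GAD d F, ∀ Z : ZeroDimScheme k n,
      IsEvincedBy Z D ↔ Z.ideal = ⨅ i, naturalApolarIdeal (G i) (L i) := by
  choose e H he hH hLH G_eq using fun i =>
    exists_eq_pow_mul_and_not_dvd (hG i) (hG0 i) (hL i) (hL0 i)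
  let σ := (Fintype.equivFin ι).symm
  let D : GAD d F :=
    { s := Fintype.card ι
      L := fun i => L (σ i)
      deg := fun i => e (σ i)
      G := fun i => H (σ i)
      L_homogeneous := fun i => hL (σ i)
      L_ne_zero := fun i => hL0 (σ i)
      L_not_proportional := fun i j hij => hprop _ _ (σ.injective.ne hij)
      deg_le := fun i => he (σ i)
      G_homogeneous := fun i => hH (σ i)
      not_dvd := fun i => hLH (σ i)
      sum_eq := by simp only [← G_eq, hF, σ.sum_comp] }
  refine ⟨D, fun Z => ?_⟩
  simp only [IsEvincedBy, D, ← G_eq]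
  rw [σ.iInf_comp (g := fun i => naturalApolarIdeal (G i) (L i))]

theorem GAD.isHomogeneous_summand (D : GAD d F) (i : Fin D.s) :
    (D.L i ^ (d - D.deg i) * D.G i).IsHomogeneous d := by
  have := ((D.L_homogeneous i).pow (d - D.deg i)).mul (D.G_homogeneous i)
  rwa [one_mul, Nat.sub_add_cancel (D.deg_le i)] at this

theorem IsEvincedBy.iInf_pointIdeal_pow_le {Z : ZeroDimScheme k n} {D : GAD d F}
    (h : IsEvincedBy Z D) : ⨅ i, pointIdeal (D.L i) ^ (d + 1) ≤ Z.ideal := by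
  rw [h]
  exact iInf_mono fun i => pointIdeal_pow_le_naturalApolarIdeal (D.isHomogeneous_summand i)
    (D.L_homogeneous i) (D.L_ne_zero i)

end GADs

section Evincing

variable {k : Type*} [Field k] [CharZero k] {n d : ℕ} {F : MvPolynomial (Fin (n + 1)) k}
  {Z : ZeroDimScheme k n}

theorem IsIrredundant.ideal_eq (hZ : IsIrredundant Z F) {I : Ideal (MvPolynomial (Fin (n + 1)) k)}
    (I_hom : I.IsHomogeneous (homogeneousSubmodule (Fin (n + 1)) k))
    (I_sat : ∀ G, (∀ i, X i * G ∈ I) → G ∈ I) (hZI : Z.ideal ≤ I)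
    (hIF : I ≤ contractAnn (toDP F)) : Z.ideal = I := by
  let Z' : ZeroDimScheme k n :=
    { ideal := I
      homogeneous := I_hom
      saturated := I_sat
      dim_le := (ringKrullDim_le_of_surjective (Ideal.Quotient.factor hZI)
        (Ideal.Quotient.factor_surjective hZI)).trans Z.dim_le }
  have Z'_eq : Z' = Z := hZ.2 Z' hZI fun G hG => (diffAct_eq_zero_iff G F).2 (hIF hG)
  rw [← Z'_eq]

theorem IsIrredundant.exists_isEvincedBy (hZ : IsIrredundant Z F) {ι : Type*} [Fintype ι]
    {G L : ι → MvPolynomial (Fin (n + 1)) k} (hG : ∀ i, (G i).IsHomogeneous d)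
    (hL : ∀ i, (L i).IsHomogeneous 1) (hL0 : ∀ i, L i ≠ 0)
    (hprop : ∀ i j, i ≠ j → ∀ c : k, L i ≠ c • L j) (hF : F = ∑ i, G i)
    (hZG : ∀ i, Z.ideal ≤ naturalApolarIdeal (G i) (L i)) : ∃ D : GAD d F, IsEvincedBy Z D := by
  classical
  let κ := {i // G i ≠ 0}
  have F_eq : F = ∑ i : κ, G i.1 := by
    rw [hF, ← Finset.sum_filter_ne_zero]
    exact Finset.sum_subtype _ (by simp) G
  obtain ⟨D, hD⟩ := exists_GAD (fun i : κ => hG i) (fun i => i.2) (fun i => hL i) (fun i => hL0 i)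
    (fun i j hij => hprop i j (Subtype.coe_injective.ne hij)) F_eq
  refine ⟨D, (hD Z).2 (hZ.ideal_eq ?_ (fun H hH => ?_) (le_iInf fun i => hZG i) ?_)⟩
  · exact .iInf fun i => naturalApolarIdeal_isHomogeneous _ (hL i) (hL0 i)
  · exact Ideal.mem_iInf.2 fun i => naturalApolarIdeal_saturated (hL i) (hL0 i)
      fun j => Ideal.mem_iInf.1 (hH j) i
  · rw [F_eq, toDP_sum]
    exact (iInf_mono fun i : κ => naturalApolarIdeal_le_contractAnn (hG i) (hL i) (hL0 i)).trans
      (iInf_contractAnn_le fun i : κ => toDP (G i))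

theorem IsIrredundant.exists_isEvincedBy_of_pointIdeal_pow_le (hF : F.IsHomogeneous d)
    (hZ : IsIrredundant Z F) {L : Z.ideal.minimalPrimes → MvPolynomial (Fin (n + 1)) k}
    (hL : ∀ P, (L P).IsHomogeneous 1) (hL0 : ∀ P, L P ≠ 0)
    (hfat : ∀ P, pointIdeal (L P) ^ (d + 1) ≤ componentIdeal Z P.1) :
    ∃ D : GAD d F, IsEvincedBy Z D := by
  have := (Ideal.finite_minimalPrimes_of_isNoetherianRing _ Z.ideal).fintype
  have P_eq (P : Z.ideal.minimalPrimes) : P.1 = pointIdeal (L P) := by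
    obtain ⟨i, hi⟩ := exists_X_notMem_of_mem_minimalPrimes Z.homogeneous Z.saturated P.2
    exact eq_pointIdeal_of_le (isHomogeneous_of_mem_minimalPrimes Z.homogeneous P.2)
      (P.2.1.1.le_of_pow_le ((hfat P).trans (componentIdeal_le Z P.2.1.2))) hi
  obtain ⟨G, hG, F_eq, hZG⟩ := exists_sum_eq_of_iInf_le_contractAnn_toDP
    (fun P : Z.ideal.minimalPrimes => homogeneousComponentIdeal_isHomogeneous Z P.1) hF
    ((iInf_homogeneousComponentIdeal_le Z fun P hP => ⟨L ⟨P, hP⟩, P_eq ⟨P, hP⟩⟩).trans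
      fun H hH => (diffAct_eq_zero_iff H F).1 (hZ.1 H hH))
  refine hZ.exists_isEvincedBy hG hL hL0 (fun P P' hne c hc => hne (Subtype.ext ?_)) F_eq
    fun P => (ideal_le_homogeneousComponentIdeal Z (P := P.1)).trans ?_
  · have hc0 : c ≠ 0 := fun h => hL0 P (by rw [hc, h, zero_smul])
    rw [P_eq, P_eq, hc, pointIdeal_smul _ hc0]
  · exact le_naturalApolarIdeal (hG P) (hL P) (hL0 P)
      (homogeneousComponentIdeal_isHomogeneous Z P.1)
      (fun M H hM hMP hMH =>
        mem_homogeneousComponentIdeal_of_mul_mem Z hM (P_eq P ▸ hMP) hMH)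
      (le_homogeneousComponentIdeal Z (pow_isHomogeneous (pointIdeal_isHomogeneous _) _) (hfat P))
      (hZG P)

end Evincing

end Apolarity

end

theorem mainTheorem3_general {k : Type*} [Field k] [CharZero k] (n d : ℕ)
    (F : MvPolynomial (Fin (n + 1)) k) (hF : F.IsHomogeneous d)
    (Z : Apolarity.ZeroDimScheme k n) (hZ : Apolarity.IsIrredundant Z F) :
    List.TFAE [∃ D : Apolarity.GAD d F, Apolarity.IsEvincedBy Z D,
      ∃ (s : ℕ) (L : Fin s → MvPolynomial (Fin (n + 1)) k),
        (∀ i, (L i).IsHomogeneous 1 ∧ L i ≠ 0) ∧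
          ⨅ i, Apolarity.pointIdeal (L i) ^ (d + 1) ≤ Z.ideal,
      ∀ (P : Ideal (MvPolynomial (Fin (n + 1)) k)) [P.IsPrime], P ∈ Z.ideal.minimalPrimes →
        ∃ L : MvPolynomial (Fin (n + 1)) k, L.IsHomogeneous 1 ∧ L ≠ 0 ∧
          Apolarity.pointIdeal L ^ (d + 1) ≤ Apolarity.componentIdeal Z P] := by
  tfae_have 1 → 2 := fun ⟨D, hD⟩ =>
    ⟨D.s, D.L, fun i => ⟨D.L_homogeneous i, D.L_ne_zero i⟩, hD.iInf_pointIdeal_pow_le⟩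
  tfae_have 2 → 3 := fun ⟨s, L, hL, hLZ⟩ P _ hP =>
    have ⟨i, hi⟩ := Apolarity.exists_pointIdeal_pow_le_componentIdeal Z hLZ hP
    ⟨L i, (hL i).1, (hL i).2, hi⟩
  tfae_have 3 → 1 := fun h => by
    choose L hL hL0 hfat using fun P : Z.ideal.minimalPrimes => h P.1 P.2
    exact hZ.exists_isEvincedBy_of_pointIdeal_pow_le hF hL hL0 hfat
  tfae_finish

theorem mainTheorem3 {k : Type*} [Field k] [IsAlgClosed k] [CharZero k] (n d : ℕ)
    (F : MvPolynomial (Fin (n + 1)) k) (hF : F.IsHomogeneous d)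
    (Z : Apolarity.ZeroDimScheme k n) (hZ : Apolarity.IsIrredundant Z F) :
    ((∃ D : Apolarity.GAD d F, Apolarity.IsEvincedBy Z D) ↔
      ∃ (s : ℕ) (L : Fin s → MvPolynomial (Fin (n + 1)) k),
        (∀ i, (L i).IsHomogeneous 1 ∧ L i ≠ 0) ∧
          ⨅ i, Apolarity.pointIdeal (L i) ^ (d + 1) ≤ Z.ideal) ∧
    ((∃ D : Apolarity.GAD d F, Apolarity.IsEvincedBy Z D) ↔
      ∀ (P : Ideal (MvPolynomial (Fin (n + 1)) k)) [P.IsPrime], P ∈ Z.ideal.minimalPrimes →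
        ∃ L : MvPolynomial (Fin (n + 1)) k, L.IsHomogeneous 1 ∧ L ≠ 0 ∧
          Apolarity.pointIdeal L ^ (d + 1) ≤ Apolarity.componentIdeal Z P) := by
  have tfae := mainTheorem3_general n d F hF Z hZ
  exact ⟨tfae.out 0 1, tfae.out 0 2⟩
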